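/- For a graph $H$ and a finite graph $G$, let $n_H(G)$ denote the number of subgraphs of $G$ isomorphic to $H$. The $H$-bootstrap percolation process with starting graph $G$ is the sequence of graphs $G_0, G_1, \ldots$ on the vertex set $V(G)$ given by $G_0 := G$ and $$E(G_{i}) := E(G_{i-1}) \cup \left\{ e \in \tbinom{V(G)}{2} : n_H(G_{i-1}+e) > n_H(G_{i-1}) \right\} \qquad (i \geq 1).$$ Its running time is $\tau_H(G) := \min\{t \geq 0 : G_t = G_{t+1}\}$, and $M_H(n) := \max_{|V(G)| = n} \tau_H(G)$ is the maximum running time over all $n$-vertex starting graphs $G$. Theorem 1.4. Let $s \geq 2$, let $k_1 \geq \ldots \geq k_s \geq 3$ be integers and let $H := C_{k_1} \sqcup \ldots \sqcup C_{k_s}$ be the disjoint union of cycles of lengths $k_1, \ldots, k_s$. Then for all sufficiently large $n$ (in terms of $k_1, \ldots, k_s$), $$\log_{k_1-1}(n) - 1 \leq M_H(n) < \log_{k_1-1}(n) + k_1^3 s^4.$$ -/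

import Mathlib

namespace Bootstrap

open SimpleGraph

/-- The external disjoint union of a family of graphs. -/
def disjointUnion {ι : Type*} {V : ι → Type*} (G : ∀ i, SimpleGraph (V i)) :
    SimpleGraph (Σ i, V i) :=
  ⨆ i, (G i).map (Function.Embedding.sigmaMk i)

theorem disjointUnion_adj {ι : Type*} {V : ι → Type*} (G : ∀ i, SimpleGraph (V i))
    (x y : Σ i, V i) :
    (disjointUnion G).Adj x y ↔ ∃ i a b, (G i).Adj a b ∧ (⟨i, a⟩ : Σ i, V i) = x ∧ ⟨i, b⟩ = y := by
  simp [disjointUnion, SimpleGraph.map_adj]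

/-- The disjoint union of cycles of lengths `k 0, …, k (s - 1)`. -/
def cycles {s : ℕ} (k : Fin s → ℕ) : SimpleGraph (Σ i, Fin (k i)) :=
  disjointUnion fun i => cycleGraph (k i)

section Steps

variable {W : Type*} (H : SimpleGraph W) {V : Type*} [Fintype V]

/-- One step of the `H`-process: `G` together with all `e` such that `G + e` contains more
(unlabelled) copies of `H` than `G`. -/
def step (G : SimpleGraph V) : SimpleGraph V where
  Adj u v := G.Adj u v ∨ (u ≠ v ∧ G.copyCount H < (G ⊔ edge u v).copyCount H)
  symm := ⟨by
    rintro u v (h | ⟨h, h'⟩)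
    · exact Or.inl h.symm
    · exact Or.inr ⟨h.symm, by rwa [edge_comm]⟩⟩
  loopless := ⟨by
    rintro u (h | ⟨h, _⟩)
    · exact G.loopless.irrefl u h
    · exact h rfl⟩

/-- The `H`-bootstrap percolation process with starting graph `G`. -/
def process (G : SimpleGraph V) : ℕ → SimpleGraph V
  | 0 => G
  | i + 1 => step H (process G i)

theorem process_mono (G : SimpleGraph V) : Monotone (process H G) :=
  monotone_nat_of_le_succ fun _ _ _ h => Or.inl h

/-- The process stabilises, so that the infimum in `runningTime` is a minimum. -/
theorem exists_process_eq (G : SimpleGraph V) : ∃ t, process H G t = process H G (t + 1) := by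
  by_contra! h
  have hs : StrictMono (process H G) :=
    strictMono_nat_of_lt_succ fun t => lt_of_le_of_ne (process_mono H G t.le_succ) (h t)
  exact not_injective_infinite_finite _ hs.injective

/-- The least `t` with `G_t = G_{t+1}`. -/
noncomputable def runningTime (G : SimpleGraph V) : ℕ :=
  sInf {t : ℕ | process H G t = process H G (t + 1)}

open Classical in
/-- The maximum running time of the `H`-process over all starting graphs with `n` vertices. -/
noncomputable def maxRunningTime (n : ℕ) : ℕ :=
  (Finset.univ : Finset (SimpleGraph (Fin n))).sup fun G => runningTime H G

end Steps

end Bootstrap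

/-! A step adds `uv` exactly when vertex-disjoint closed walks of the prescribed lengths use `uv`
and otherwise edges already present (`step_cycles_adj_iff`). Hence a new edge joins the ends of a
path on `k j` vertices for some `j`, and conversely such a path is closed up whenever disjoint
cycles of the other lengths are available.

Lower bound: start from a clique on `∑ k i` vertices followed by a long path. The clique supplies
the spare cycles, so in the stable graph the first path vertex is joined to vertices near the far
end. An edge added in one step spans at most `k₁ - 1` times the previous maximum distance, so this
takes about `log n` steps to base `k₁ - 1`.

Upper bound: unless the process stops at once, `G₁` contains disjoint cycles of all lengths; fix
such a `CycleSystem`. Shortest paths towards the cycles shrink by a factor `b = k₁ - 1` per step, so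
after `log_b n + O(b)` steps each vertex in a component meeting the cycles lies on a cycle or has a
neighbour on one (`exists_attached_of_reachable`).

Near the cycles, the neighbourhood of an outside vertex on a cycle spreads over a parity class, and
three vertices attached to two common cycles force everything attached to one to become attached to
the other (`attached_of_three`). A bounded monotone quantity, `progress`, must therefore be constant
on some long time window. In that window, the vertices attached to a given cycle form either a
clique joined completely to the cycle or a bipartite pattern governed by parity. Up to boundedly
many exceptional vertices this gives boundedly many twin classes (`exists_twin_classes`). Twins stay
twins, so each later step with a new edge there joins a new pair of classes, which bounds the number
of such steps (`le_sq_of_forall_exists_new_adj`).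

A component avoiding the cycles evolves by itself and stops once it pauses. If it were still active
late, it would have been active from the start and would contain a cycle that can be swapped into
the system; the previous bound for the new system is then contradicted. -/

namespace Bootstrap

open SimpleGraph Finset

/-! ### Index conventions: cycles indexed by `ZMod`, and paths as sequences. -/

section Preliminaries

variable {V : Type*} {G : SimpleGraph V} {s : ℕ} {k : Fin s → ℕ}

/-- A subgraph of a graph regarded as a subgraph of a larger graph. -/
def inclSubgraph {G G' : SimpleGraph V} (h : G ≤ G') (B : G.Subgraph) : G'.Subgraph where
  verts := B.verts
  Adj := B.Adj
  adj_sub hab := h (B.adj_sub hab)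
  edge_vert hab := B.edge_vert hab
  symm := B.symm

theorem inclSubgraph_injective {G G' : SimpleGraph V} (h : G ≤ G') :
    Function.Injective (inclSubgraph h) := by
  intro A B hAB
  refine Subgraph.ext ?_ ?_
  · exact congrArg (fun C : G'.Subgraph => C.verts) hAB
  · exact congrArg (fun C : G'.Subgraph => C.Adj) hAB

theorem cycleGraph_adj_finEquiv {n : ℕ} [NeZero n] (hn : 3 ≤ n) (a b : Fin n) :
    (cycleGraph n).Adj a b ↔ ZMod.finEquiv n a = ZMod.finEquiv n b + 1 ∨
      ZMod.finEquiv n b = ZMod.finEquiv n a + 1 := by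
  obtain ⟨m, rfl⟩ : ∃ m, n = m + 2 := ⟨n - 2, by omega⟩
  rw [cycleGraph_adj, sub_eq_iff_eq_add', sub_eq_iff_eq_add']
  exact Iff.rfl

theorem cycles_adj (x y : Σ i, Fin (k i)) :
    (cycles k).Adj x y ↔ ∃ i a b, (cycleGraph (k i)).Adj a b ∧ (⟨i, a⟩ : Σ i, Fin (k i)) = x ∧
      ⟨i, b⟩ = y :=
  disjointUnion_adj _ x y

/-- A family of maps is jointly injective. -/
def JointlyInjective (c : ∀ j, ZMod (k j) → V) : Prop :=
  ∀ i j x y, c i x = c j y → (⟨i, x⟩ : Σ i, ZMod (k i)) = ⟨j, y⟩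

/-- The first `m` terms of `p` are the vertices of a path. -/
def IsPathSeq (G : SimpleGraph V) (m : ℕ) (p : ℕ → V) : Prop :=
  (∀ i, i + 1 < m → G.Adj (p i) (p (i + 1))) ∧ ∀ i < m, ∀ j < m, p i = p j → i = j

theorem IsPathSeq.reverse {m : ℕ} {p : ℕ → V} (h : IsPathSeq G m p) :
    IsPathSeq G m fun i => p (m - 1 - i) := by
  refine ⟨fun i hi => ?_, fun i hi j hj hij => ?_⟩
  · have := h.1 (m - 1 - (i + 1)) (by omega)
    rw [show m - 1 - (i + 1) + 1 = m - 1 - i by omega] at this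
    exact this.symm
  · have := h.2 _ (by omega) _ (by omega) hij
    omega

theorem ZMod.val_add_one_cases {n : ℕ} (hn : 3 ≤ n) (z : ZMod n) :
    (z.val + 1 < n ∧ (z + 1).val = z.val + 1) ∨ (z.val = n - 1 ∧ (z + 1).val = 0) := by
  have : NeZero n := ⟨by omega⟩
  have : Fact (1 < n) := ⟨by omega⟩
  have hz := ZMod.val_lt z
  rcases Nat.lt_or_ge (z.val + 1) n with h | h
  · left
    refine ⟨h, ?_⟩
    rw [ZMod.val_add_of_lt] <;> rw [ZMod.val_one] 
    exact h
  · right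
    refine ⟨by omega, ?_⟩
    rw [ZMod.val_add, ZMod.val_one, show z.val + 1 = n by omega, Nat.mod_self]

end Preliminaries

/-! ### One step in terms of embeddings of `H`. -/

section StepCharacterisation

variable {W : Type*} {H : SimpleGraph W} {V : Type*} [Fintype V] {G : SimpleGraph V}

/-- Copies in `G` remain copies in `G + uv`, injectively. So the count grows exactly when some copy
in `G + uv` does not come from `G`, that is, uses the edge `uv`. -/
theorem step_adj_iff {u v : V} :
    (step H G).Adj u v ↔ G.Adj u v ∨ (u ≠ v ∧ ∃ f : W → V, Function.Injective f ∧
      (∀ a b, H.Adj a b → G.Adj (f a) (f b) ∨ s(f a, f b) = s(u, v)) ∧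
      ∃ a b, H.Adj a b ∧ s(f a, f b) = s(u, v)) := by
  classical
  by_cases huv : G.Adj u v
  · exact ⟨fun _ => Or.inl huv, fun _ => Or.inl huv⟩
  have hle : G ≤ G ⊔ edge u v := le_sup_left
  have key : (step H G).Adj u v ↔ u ≠ v ∧ G.copyCount H < (G ⊔ edge u v).copyCount H :=
    ⟨fun h => h.resolve_left huv, fun h => Or.inr h⟩
  rw [key, or_iff_right huv, and_congr_right_iff]
  intro hne
  have hadj : ∀ x y, (G ⊔ edge u v).Adj x y ↔ G.Adj x y ∨ s(x, y) = s(u, v) := by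
    intro x y
    simp only [sup_adj, edge_adj, Sym2.eq_iff]
    constructor
    · rintro (h | ⟨h, _⟩)
      · exact Or.inl h
      · exact Or.inr h
    · rintro (h | h)
      · exact Or.inl h
      · refine Or.inr ⟨h, ?_⟩
        rcases h with ⟨rfl, rfl⟩ | ⟨rfl, rfl⟩
        · exact hne
        · exact hne.symm
  have himage : (univ.filter fun B : G.Subgraph => Nonempty (H ≃g B.coe)).image (inclSubgraph hle) ⊆
      univ.filter fun B : (G ⊔ edge u v).Subgraph => Nonempty (H ≃g B.coe) := by
    intro B hB
    simp only [mem_image, mem_filter, mem_univ, true_and] at hB ⊢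
    obtain ⟨A, ⟨e⟩, rfl⟩ := hB
    exact ⟨⟨e.toEquiv, e.map_rel_iff'⟩⟩
  have hcard := card_image_of_injective
    (univ.filter fun B : G.Subgraph => Nonempty (H ≃g B.coe)) (inclSubgraph_injective hle)
  have hc1 : G.copyCount H = #(univ.filter fun B : G.Subgraph => Nonempty (H ≃g B.coe)) := by
    simp only [copyCount]
  have hc2 : (G ⊔ edge u v).copyCount H =
      #(univ.filter fun B : (G ⊔ edge u v).Subgraph => Nonempty (H ≃g B.coe)) := by
    simp only [copyCount]; congr!
  rw [hc1, hc2, ← hcard]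
  constructor
  · intro hlt
    obtain ⟨B, hB, hB'⟩ := exists_mem_notMem_of_card_lt_card hlt
    simp only [mem_image, mem_filter, mem_univ, true_and, not_exists, not_and] at hB hB'
    obtain ⟨e⟩ := hB
    have hBuv : B.Adj u v := by
      by_contra hn
      refine hB' ⟨B.verts, B.Adj, ?_, B.edge_vert, B.symm⟩ ⟨⟨e.toEquiv, e.map_rel_iff'⟩⟩ rfl
      intro x y hxy
      rcases (hadj x y).1 (B.adj_sub hxy) with h | h
      · exact h
      · exfalso
        rcases Sym2.eq_iff.1 h with ⟨rfl, rfl⟩ | ⟨rfl, rfl⟩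
        · exact hn hxy
        · exact hn (B.symm.symm _ _ hxy)
    refine ⟨fun w => (e w : V), fun a b hab => e.injective (Subtype.ext hab), ?_, ?_⟩
    · intro a b hab
      exact (hadj _ _).1 (B.adj_sub (e.map_rel_iff.2 hab))
    · refine ⟨e.symm ⟨u, B.edge_vert hBuv⟩, e.symm ⟨v, B.edge_vert hBuv.symm⟩, ?_, ?_⟩
      · rw [← e.map_rel_iff]
        simpa using hBuv
      · simp
  · rintro ⟨f, hf, hHf, a, b, hab, hfab⟩
    let F : Copy H (G ⊔ edge u v) := ⟨⟨f, fun {a b} h => (hadj _ _).2 (hHf a b h)⟩, hf⟩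
    refine card_lt_card ⟨himage, fun hsub => ?_⟩
    have hmem : F.toSubgraph ∈
        univ.filter fun B : (G ⊔ edge u v).Subgraph => Nonempty (H ≃g B.coe) := by
      simp only [mem_filter, mem_univ, true_and]
      exact ⟨F.isoToSubgraph⟩
    have hm := hsub hmem
    simp only [mem_image, mem_filter, mem_univ, true_and] at hm
    obtain ⟨A, -, hA⟩ := hm
    have hF : F.toSubgraph.Adj (f a) (f b) := by
      refine ⟨a, b, hab, rfl, rfl⟩
    rw [← hA] at hF
    have hG : G.Adj (f a) (f b) := A.adj_sub hF
    rcases Sym2.eq_iff.1 hfab with ⟨h1, h2⟩ | ⟨h1, h2⟩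
    · rw [h1, h2] at hG; exact huv hG
    · rw [h1, h2] at hG; exact huv hG.symm

/-- Automorphisms of a graph remain automorphisms after a step of the process. -/
theorem step_adj_map (σ : Equiv.Perm V) (hσ : ∀ a b, G.Adj a b → G.Adj (σ a) (σ b)) {u v : V}
    (h : (step H G).Adj u v) : (step H G).Adj (σ u) (σ v) := by
  rw [step_adj_iff] at h ⊢
  rcases h with h | ⟨hne, f, hf, hHf, a, b, hab, hfab⟩
  · exact Or.inl (hσ _ _ h)
  · have hs : ∀ x y, s(x, y) = s(u, v) → s(σ x, σ y) = s(σ u, σ v) := by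
      intro x y hxy
      simpa using congrArg (Sym2.map σ) hxy
    refine Or.inr ⟨σ.injective.ne hne, σ ∘ f, σ.injective.comp hf, ?_, a, b, hab, hs _ _ hfab⟩
    intro a b hab
    rcases hHf a b hab with h | h
    · exact Or.inl (hσ _ _ h)
    · exact Or.inr (hs _ _ h)

end StepCharacterisation

/-! ### One step for disjoint unions of cycles. -/

section Cycles

variable {V : Type*} [Fintype V] {G : SimpleGraph V} {s : ℕ} {k : Fin s → ℕ}

/-- Description of a step of the process by vertex-disjoint closed walks. -/
theorem step_cycles_adj_iff (hk : ∀ i, 3 ≤ k i) {u v : V} :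
    (step (cycles k) G).Adj u v ↔ G.Adj u v ∨ (u ≠ v ∧ ∃ c : ∀ j, ZMod (k j) → V,
      JointlyInjective c ∧
      (∀ j x, G.Adj (c j x) (c j (x + 1)) ∨ s(c j x, c j (x + 1)) = s(u, v)) ∧
      ∃ j x, s(c j x, c j (x + 1)) = s(u, v)) := by
  have : ∀ i, NeZero (k i) := fun i => ⟨by have := hk i; omega⟩
  rw [step_adj_iff]
  refine or_congr_right (and_congr_right fun hne => ?_)
  constructor
  · rintro ⟨f, hf, hHf, x, y, hxy, hfxy⟩
    refine ⟨fun j z => f ⟨j, (ZMod.finEquiv (k j)).symm z⟩, ?_, ?_, ?_⟩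
    · intro i j x y hxy
      have h := hf hxy
      rw [Sigma.mk.injEq] at h
      obtain ⟨rfl, h⟩ := h
      have h' := (ZMod.finEquiv (k i)).symm.injective (eq_of_heq h)
      rw [h']
    · intro j z
      refine hHf _ _ ((cycles_adj _ _).2 ⟨j, _, _, ?_, rfl, rfl⟩)
      rw [cycleGraph_adj_finEquiv (hk j)]
      right; simp
    · obtain ⟨i, a, b, hab, rfl, rfl⟩ := (cycles_adj _ _).1 hxy
      rw [cycleGraph_adj_finEquiv (hk i)] at hab
      rcases hab with hab | hab
      · refine ⟨i, ZMod.finEquiv (k i) b, ?_⟩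
        simp only [← hab, RingEquiv.symm_apply_apply]
        rw [Sym2.eq_swap, hfxy]
      · refine ⟨i, ZMod.finEquiv (k i) a, ?_⟩
        simp only [← hab, RingEquiv.symm_apply_apply]
        exact hfxy
  · rintro ⟨c, hc, hG, j, x, hjx⟩
    refine ⟨fun z => c z.1 (ZMod.finEquiv (k z.1) z.2), ?_, ?_, ?_⟩
    · rintro ⟨i, a⟩ ⟨j, b⟩ hab
      have h := hc _ _ _ _ hab
      rw [Sigma.mk.injEq] at h
      obtain ⟨h1, h⟩ := h
      dsimp only at h1
      subst h1
      have h' : a = b := (ZMod.finEquiv (k i)).injective (eq_of_heq h)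
      rw [h']
    · intro a' b' hab'
      obtain ⟨i, a, b, hab, rfl, rfl⟩ := (cycles_adj _ _).1 hab'
      rw [cycleGraph_adj_finEquiv (hk i)] at hab
      dsimp only
      rcases hab with hab | hab
      · rw [hab, Sym2.eq_swap, adj_comm]
        exact hG _ _
      · rw [hab]
        exact hG _ _
    · refine ⟨⟨j, (ZMod.finEquiv (k j)).symm x⟩, ⟨j, (ZMod.finEquiv (k j)).symm (x + 1)⟩, ?_, ?_⟩
      · refine (cycles_adj _ _).2 ⟨j, _, _, ?_, rfl, rfl⟩
        rw [cycleGraph_adj_finEquiv (hk j)]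
        right; simp
      · simpa using hjx

/-- A path on `k j` vertices that is disjoint from cycles of the other lengths is closed up in the
next step. -/
theorem step_adj_of_isPathSeq (hk : ∀ i, 3 ≤ k i) {j : Fin s} {p : ℕ → V}
    (hp : IsPathSeq G (k j) p) (c : ∀ i, ZMod (k i) → V)
    (hc : ∀ i, i ≠ j → ∀ x, G.Adj (c i x) (c i (x + 1)))
    (hinj : ∀ i, i ≠ j → ∀ i', i' ≠ j → ∀ x y, c i x = c i' y →
      (⟨i, x⟩ : Σ i, ZMod (k i)) = ⟨i', y⟩)
    (hd : ∀ i, i ≠ j → ∀ x, ∀ m < k j, p m ≠ c i x) :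
    (step (cycles k) G).Adj (p 0) (p (k j - 1)) := by
  classical
  have : ∀ i, NeZero (k i) := fun i => ⟨by have := hk i; omega⟩
  have hkj := hk j
  rw [step_cycles_adj_iff hk]
  right
  -- The new edge is the wrap-around edge of the `j`-th cycle: index `-1` has value `k j - 1`, and
  -- its successor is `0`.
  refine ⟨fun h => ?_, Function.update c j (fun z => p z.val), ?_, ?_, j, -1, ?_⟩
  · have := hp.2 _ (by omega) _ (by omega) h
    omega
  · intro i i' x y hxy
    by_cases hi : i = j <;> by_cases hi' : i' = j
    · subst hi; subst hi'
      simp only [Function.update_self] at hxy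
      rw [ZMod.val_injective _ (hp.2 _ (ZMod.val_lt x) _ (ZMod.val_lt y) hxy)]
    · subst hi
      rw [Function.update_self, Function.update_of_ne hi'] at hxy
      exact absurd hxy (hd i' hi' y _ (ZMod.val_lt x))
    · subst hi'
      rw [Function.update_self, Function.update_of_ne hi] at hxy
      exact absurd hxy.symm (hd i hi x _ (ZMod.val_lt y))
    · rw [Function.update_of_ne hi, Function.update_of_ne hi'] at hxy
      exact hinj i hi i' hi' x y hxy
  · intro i x
    by_cases hi : i = j
    · subst hi
      simp only [Function.update_self]
      rcases ZMod.val_add_one_cases hkj x with ⟨h1, h2⟩ | ⟨h1, h2⟩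
      · rw [h2]
        exact Or.inl (hp.1 _ h1)
      · rw [h1, h2, Sym2.eq_swap]
        exact Or.inr rfl
    · rw [Function.update_of_ne hi]
      exact Or.inl (hc i hi x)
  · simp only [Function.update_self]
    rcases ZMod.val_add_one_cases hkj (-1 : ZMod (k j)) with ⟨h1, h2⟩ | ⟨h1, h2⟩
    · simp at h2
    · rw [h1, h2, Sym2.eq_swap]

/-- An edge added in a step joins the ends of a path on `k j` vertices, for some `j`. -/
theorem exists_isPathSeq_of_step_adj (hk : ∀ i, 3 ≤ k i) {u v : V}
    (h : (step (cycles k) G).Adj u v) (huv : ¬ G.Adj u v) :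
    ∃ j p, IsPathSeq G (k j) p ∧ p 0 = u ∧ p (k j - 1) = v := by
  have : ∀ i, NeZero (k i) := fun i => ⟨by have := hk i; omega⟩
  obtain ⟨hne, c, hc, hG, j, z, hz⟩ := ((step_cycles_adj_iff hk).1 h).resolve_left huv
  have hkj := hk j
  have hci : Function.Injective (c j) := by
    intro x y hxy
    simpa using hc j j x y hxy
  have hcast : ((k j : ℕ) : ZMod (k j)) = 0 := ZMod.natCast_self _
  have hsmall : ∀ m : ℕ, 0 < m → m < k j → (m : ZMod (k j)) ≠ 0 := by
    intro m h0 h1 h2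
    rw [ZMod.natCast_eq_zero_iff] at h2
    exact absurd (Nat.le_of_dvd h0 h2) (by omega)
  have hpath : IsPathSeq G (k j) fun m => c j (z + 1 + m) := by
    refine ⟨fun i hi => ?_, fun a ha b hb hab => ?_⟩
    · have h1 := (hG j (z + 1 + i)).resolve_right ?_
      · dsimp only
        rw [show z + 1 + ((i + 1 : ℕ) : ZMod (k j)) = z + 1 + i + 1 by push_cast; ring]
        exact h1
      · rw [← hz]
        intro h2
        rcases Sym2.eq_iff.1 h2 with ⟨h3, -⟩ | ⟨h3, h4⟩
        · have := hci h3
          refine hsmall (i + 1) (by omega) hi ?_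
          push_cast
          linear_combination this
        · have h5 := hci h3
          have h6 := hci h4
          refine hsmall 2 (by omega) (by omega) ?_
          push_cast
          linear_combination h6 - h5
    · have h1 := add_left_cancel (hci hab)
      rw [ZMod.natCast_eq_natCast_iff'] at h1
      rwa [Nat.mod_eq_of_lt ha, Nat.mod_eq_of_lt hb] at h1
  have hend : z + 1 + ((k j - 1 : ℕ) : ZMod (k j)) = z := by
    rw [Nat.cast_sub (by omega), hcast]; simp
  rcases Sym2.eq_iff.1 hz with ⟨h1, h2⟩ | ⟨h1, h2⟩
  · refine ⟨j, _, hpath.reverse, ?_, ?_⟩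
    · simp only [Nat.sub_zero]; rw [hend, h1]
    · simp only [Nat.sub_self]; simp [h2]
  · refine ⟨j, _, hpath, ?_, ?_⟩
    · simp [h2]
    · rw [hend, h1]

/-- If a step adds an edge, the graph afterwards contains disjoint cycles of all lengths. -/
theorem exists_cycles_of_step_ne (hk : ∀ i, 3 ≤ k i) (h : step (cycles k) G ≠ G) :
    ∃ c : ∀ j, ZMod (k j) → V, JointlyInjective c ∧
      ∀ j x, (step (cycles k) G).Adj (c j x) (c j (x + 1)) := by
  have hle : G ≤ step (cycles k) G := fun _ _ h => Or.inl h
  obtain ⟨u, v, huv, hn⟩ : ∃ u v, (step (cycles k) G).Adj u v ∧ ¬ G.Adj u v := by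
    by_contra! hcon
    exact h (le_antisymm (fun u v huv => hcon u v huv) hle)
  obtain ⟨hne, c, hc, hG, -⟩ := ((step_cycles_adj_iff hk).1 huv).resolve_left hn
  refine ⟨c, hc, fun j x => ?_⟩
  rcases hG j x with h | h
  · exact hle h
  · rcases Sym2.eq_iff.1 h with ⟨h1, h2⟩ | ⟨h1, h2⟩
    · rw [h1, h2]; exact huv
    · rw [h1, h2]; exact huv.symm

end Cycles

/-! ### Lower bound: a clique with a long tail. -/

section LowerBound

theorem process_runningTime {W V : Type*} [Fintype V] (H : SimpleGraph W) (G : SimpleGraph V) :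
    process H G (runningTime H G) = process H G (runningTime H G + 1) :=
  Nat.sInf_mem (s := {t : ℕ | process H G t = process H G (t + 1)}) (exists_process_eq H G)

theorem runningTime_le {W V : Type*} [Fintype V] {H : SimpleGraph W} {G : SimpleGraph V} {t : ℕ}
    (h : process H G t = process H G (t + 1)) : runningTime H G ≤ t :=
  Nat.sInf_le h

theorem runningTime_le_maxRunningTime {W : Type*} (H : SimpleGraph W) {n : ℕ}
    (G : SimpleGraph (Fin n)) : runningTime H G ≤ maxRunningTime H n := by
  classical
  unfold maxRunningTime
  exact Finset.le_sup (f := fun G => runningTime H G) (mem_univ G)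

theorem abs_sub_le_of_isPathSeq {V : Type*} {G : SimpleGraph V} {pos : V → ℤ} {B : ℤ}
    (hB : ∀ u v, G.Adj u v → |pos u - pos v| ≤ B) {m : ℕ} {p : ℕ → V} (hp : IsPathSeq G m p)
    {i : ℕ} (hi : i < m) : |pos (p 0) - pos (p i)| ≤ i * B := by
  induction i with
  | zero => simp
  | succ i ih =>
    calc |pos (p 0) - pos (p (i + 1))|
        ≤ |pos (p 0) - pos (p i)| + |pos (p i) - pos (p (i + 1))| := abs_sub_le _ _ _
      _ ≤ i * B + B := add_le_add (ih (by omega)) (hB _ _ (hp.1 i hi))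
      _ = ((i + 1 : ℕ) : ℤ) * B := by push_cast; ring

/-- In one step of the process, distances shrink by a factor of at most `b`, where `b + 1` is the
maximum cycle length. -/
theorem abs_sub_le_of_process_adj {V : Type*} [Fintype V] {s : ℕ} {k : Fin s → ℕ}
    (hk : ∀ i, 3 ≤ k i) {b : ℕ} (hb1 : 1 ≤ b) (hb : ∀ i, k i ≤ b + 1) {G : SimpleGraph V}
    {pos : V → ℤ} (hpos : ∀ u v, G.Adj u v → |pos u - pos v| ≤ 1) (t : ℕ) :
    ∀ u v, (process (cycles k) G t).Adj u v → |pos u - pos v| ≤ (b : ℤ) ^ t := by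
  induction t with
  | zero => simpa [process] using hpos
  | succ t ih =>
    intro u v huv
    by_cases h : (process (cycles k) G t).Adj u v
    · calc |pos u - pos v| ≤ (b : ℤ) ^ t := ih u v h
        _ ≤ (b : ℤ) ^ (t + 1) := pow_le_pow_right₀ (by exact_mod_cast hb1) (Nat.le_succ t)
    · obtain ⟨j, p, hp, rfl, rfl⟩ := exists_isPathSeq_of_step_adj hk huv h
      have hkj := hk j
      have hbj := hb j
      refine (abs_sub_le_of_isPathSeq ih hp (i := k j - 1) (by omega)).trans ?_
      rw [pow_succ']
      refine mul_le_mul_of_nonneg_right ?_ (by positivity)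
      exact_mod_cast (show k j - 1 ≤ b by omega)

/-- A clique on the vertices below `C` followed by a path on all remaining vertices. -/
def cliquePath (n C : ℕ) : SimpleGraph (Fin n) where
  Adj x y := (x ≠ y ∧ x.val < C ∧ y.val < C) ∨ x.val + 1 = y.val ∨ y.val + 1 = x.val
  symm := ⟨by
    rintro x y (⟨h, h1, h2⟩ | h | h)
    · exact Or.inl ⟨h.symm, h2, h1⟩
    · exact Or.inr (Or.inr h)
    · exact Or.inr (Or.inl h)⟩
  loopless := ⟨by
    rintro x (⟨h, -⟩ | h | h)
    · exact h rfl
    · omega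
    · omega⟩

theorem cliquePath_abs_sub_le {n C : ℕ} (u v : Fin n) (h : (cliquePath n C).Adj u v) :
    |((u.val - C : ℕ) : ℤ) - ((v.val - C : ℕ) : ℤ)| ≤ 1 := by
  rw [abs_le]
  rcases h with ⟨-, h1, h2⟩ | h | h <;> constructor <;> omega

/-- Once the process on a clique followed by a path has stabilised, the first vertex of the path is
adjacent to all vertices of the path at suitable distances. -/
theorem adj_of_step_eq_of_cliquePath_le {s : ℕ} {k : Fin s → ℕ} (hk : ∀ i, 3 ≤ k i) (j : Fin s)
    {n : ℕ} {F : SimpleGraph (Fin n)} (hF : step (cycles k) F = F)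
    (hle : cliquePath n (∑ i, k i) ≤ F) (a : ℕ)
    (ha : ∑ i, k i + (1 + a * (k j - 2)) < n) :
    F.Adj ⟨∑ i, k i, by omega⟩ ⟨∑ i, k i + (1 + a * (k j - 2)), ha⟩ := by
  have : ∀ i, NeZero (k i) := fun i => ⟨by have := hk i; omega⟩
  have hkj := hk j
  induction a with
  | zero =>
    refine hle (Or.inr (Or.inl ?_))
    simp
  | succ a ih =>
    have hmul : (a + 1) * (k j - 2) = a * (k j - 2) + (k j - 2) := by ring
    have ih := ih (by omega)
    have hn : 0 < n := by omega
    -- Reduction modulo `n` only makes the sequence total; every index that matters is below `n`.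
    let vert : ℕ → Fin n := fun i => ⟨i % n, Nat.mod_lt _ hn⟩
    have hvert : ∀ i (h : i < n), vert i = ⟨i, h⟩ := fun i h => Fin.ext (Nat.mod_eq_of_lt h)
    -- The path takes the long edge obtained by induction and then walks `k j - 2` edges along the
    -- tail, so closing it advances the far end by `k j - 2`.
    let q : ℕ → ℕ := fun m =>
      if m = 0 then ∑ i, k i else ∑ i, k i + (1 + a * (k j - 2)) + (m - 1)
    have hq : ∀ m < k j, q m < n := by
      intro m hm
      simp only [q]
      split_ifs <;> omega
    have hpath : IsPathSeq F (k j) fun m => vert (q m) := by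
      constructor
      · intro m hm
        dsimp only
        rw [hvert _ (hq m (by omega)), hvert _ (hq (m + 1) hm)]
        rcases Nat.eq_zero_or_pos m with rfl | hm0
        · simpa [q] using ih
        · refine hle (Or.inr (Or.inl ?_))
          simp only [q]
          rw [if_neg (by omega), if_neg (by omega)]
          omega
      · intro m hm m' hm' h
        dsimp only at h
        rw [hvert _ (hq m hm), hvert _ (hq m' hm'), Fin.mk.injEq] at h
        simp only [q] at h
        split_ifs at h <;> omega
    -- The clique has exactly `∑ k i` vertices; cutting it into consecutive blocks gives the spare
    -- cycles.
    let c : ∀ i, ZMod (k i) → Fin n := fun i x =>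
      vert (finSigmaFinEquiv ⟨i, (ZMod.finEquiv (k i)).symm x⟩ : Fin (∑ i, k i)).val
    have hcv : ∀ i x, (c i x).val =
        (finSigmaFinEquiv ⟨i, (ZMod.finEquiv (k i)).symm x⟩ : Fin (∑ i, k i)).val := by
      intro i x
      exact Nat.mod_eq_of_lt (lt_of_lt_of_le (Fin.is_lt _) (by omega))
    have hclt : ∀ i x, (c i x).val < ∑ i, k i := by
      intro i x
      rw [hcv]
      exact Fin.is_lt _
    have hcinj : JointlyInjective c := by
      intro i i' x y hxy
      have h := congrArg Fin.val hxy
      rw [hcv, hcv] at h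
      have h := finSigmaFinEquiv.injective (Fin.ext h)
      rw [Sigma.mk.injEq] at h
      obtain ⟨rfl, h⟩ := h
      rw [(ZMod.finEquiv (k i)).symm.injective (eq_of_heq h)]
    have hstep := step_adj_of_isPathSeq hk hpath c ?_ (fun i _ i' _ => hcinj i i') ?_
    · rw [hF] at hstep
      rw [hvert _ (hq 0 (by omega)), hvert _ (hq (k j - 1) (by omega))] at hstep
      have hq0 : q 0 = ∑ i, k i := rfl
      have hq1 : q (k j - 1) = ∑ i, k i + (1 + (a + 1) * (k j - 2)) := by
        simp only [q]
        rw [if_neg (by omega)]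
        omega
      simpa only [hq0, hq1] using hstep
    · intro i _ x
      refine hle (Or.inl ⟨fun h => ?_, hclt _ _, hclt _ _⟩)
      have h := hcinj _ _ _ _ h
      have h2 := hk i
      have : Fact (1 < k i) := ⟨by omega⟩
      simp at h
    · intro i _ x m hm h
      have h1 := hclt i x
      rw [← h, hvert _ (hq m hm)] at h1
      simp only [q] at h1
      split_ifs at h1 <;> omega

theorem logb_sub_one_le_maxRunningTime {s : ℕ} {k : Fin s → ℕ} (hk : ∀ i, 3 ≤ k i) (j : Fin s)
    (hj : ∀ i, k i ≤ k j) {n : ℕ} (hn : 2 * (∑ i, k i + k j) ≤ n) :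
    Real.logb ((k j : ℝ) - 1) n - 1 ≤ maxRunningTime (cycles k) n := by
  have hkj := hk j
  set C := ∑ i, k i with hC
  set G := cliquePath n C
  set τ := runningTime (cycles k) G
  have hτ : τ ≤ maxRunningTime (cycles k) n := runningTime_le_maxRunningTime _ G
  have hstable : step (cycles k) (process (cycles k) G τ) = process (cycles k) G τ :=
    (process_runningTime (cycles k) G).symm
  set a := (n - C - 2) / (k j - 2)
  have ha1 : a * (k j - 2) ≤ n - C - 2 := Nat.div_mul_le_self _ _
  have ha2 : n - C - 2 < a * (k j - 2) + (k j - 2) := Nat.lt_div_mul_add (by omega)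
  have ha : C + (1 + a * (k j - 2)) < n := by omega
  have hadj := adj_of_step_eq_of_cliquePath_le hk j hstable
    (process_mono (cycles k) G (Nat.zero_le τ)) a ha
  have hdist := abs_sub_le_of_process_adj (b := k j - 1) hk (by omega)
    (fun i => by have := hj i; omega) (cliquePath_abs_sub_le (n := n) (C := C)) τ _ _ hadj
  have hle : 1 + a * (k j - 2) ≤ (k j - 1) ^ τ := by
    rw [abs_le] at hdist
    have := hdist.1
    dsimp only at this
    have h2 : (((1 + a * (k j - 2) : ℕ)) : ℤ) ≤ (((k j - 1) ^ τ : ℕ) : ℤ) := by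
      rw [Nat.sub_self, Nat.add_sub_cancel_left, Nat.cast_zero] at this
      rw [Nat.cast_pow]
      linarith
    exact_mod_cast h2
  have hn' : n ≤ (k j - 1) ^ (τ + 1) := by
    -- By maximality of `a` the long edge misses the end of the tail by less than `k j - 2`. The
    -- assumption on `n` then makes its length at least `n / 2`, and the lost factor `2 ≤ k j - 1`
    -- costs the `-1` in the bound.
    calc n ≤ (1 + a * (k j - 2)) * 2 := by omega
      _ ≤ (k j - 1) ^ τ * (k j - 1) := Nat.mul_le_mul hle (by omega)
      _ = (k j - 1) ^ (τ + 1) := (pow_succ _ _).symm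
  have hcast : ((k j - 1 : ℕ) : ℝ) = (k j : ℝ) - 1 := by
    rw [Nat.cast_sub (by omega)]; simp
  have hb : (1 : ℝ) < (k j : ℝ) - 1 := by
    rw [← hcast]
    exact_mod_cast (show 1 < k j - 1 by omega)
  have hlog : Real.logb ((k j : ℝ) - 1) n ≤ (τ + 1 : ℕ) := by
    rw [Real.logb_le_iff_le_rpow hb (by exact_mod_cast (show 0 < n by omega)), Real.rpow_natCast,
      ← hcast]
    exact_mod_cast hn'
  have hτ' : (τ : ℝ) ≤ maxRunningTime (cycles k) n := by exact_mod_cast hτ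
  push_cast at hlog
  linarith

end LowerBound

/-! ### Local rules for creating edges around a fixed cycle system. -/

section Rules

variable {V : Type*} {G : SimpleGraph V} {s : ℕ} {k : Fin s → ℕ} {c : ∀ j, ZMod (k j) → V}

/-- The maps `c j` parametrise vertex-disjoint cycles of `G`. -/
structure CycleSystem (G : SimpleGraph V) (c : ∀ j, ZMod (k j) → V) : Prop where
  inj : JointlyInjective c
  adj : ∀ j x, G.Adj (c j x) (c j (x + 1))

theorem CycleSystem.mono {G' : SimpleGraph V} (h : CycleSystem G c) (hle : G ≤ G') :
    CycleSystem G' c :=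
  ⟨h.inj, fun j x => hle (h.adj j x)⟩

/-- The vertex `u` lies on none of the cycles. -/
def Outside (c : ∀ j, ZMod (k j) → V) (u : V) : Prop := ∀ j x, u ≠ c j x

theorem CycleSystem.injective (h : CycleSystem G c) (j : Fin s) : Function.Injective (c j) := by
  intro x y hxy
  simpa using h.inj j j x y hxy

theorem CycleSystem.ne (h : CycleSystem G c) {i j : Fin s} (hij : i ≠ j) (x : ZMod (k i))
    (y : ZMod (k j)) : c i x ≠ c j y := by
  intro hxy
  have := h.inj i j x y hxy
  rw [Sigma.mk.injEq] at this
  exact hij this.1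

/-- Prepend a term to a sequence. -/
def consSeq (u : V) (p : ℕ → V) : ℕ → V
  | 0 => u
  | i + 1 => p i

@[simp] theorem consSeq_zero (u : V) (p : ℕ → V) : consSeq u p 0 = u := rfl

@[simp] theorem consSeq_succ (u : V) (p : ℕ → V) (i : ℕ) : consSeq u p (i + 1) = p i := rfl

theorem IsPathSeq.cons {m : ℕ} {p : ℕ → V} (hp : IsPathSeq G m p) {u : V} (hu : G.Adj u (p 0))
    (hne : ∀ i < m, u ≠ p i) : IsPathSeq G (m + 1) (consSeq u p) := by
  constructor
  · rintro (_ | i) hi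
    · exact hu
    · exact hp.1 i (by omega)
  · rintro (_ | i) hi (_ | j) hj h
    · rfl
    · exact absurd h (hne j (by omega))
    · exact absurd h.symm (hne i (by omega))
    · rw [hp.2 i (by omega) j (by omega) h]

theorem IsPathSeq.snoc {m : ℕ} {p : ℕ → V} (hp : IsPathSeq G m p) {v : V}
    (hv : G.Adj (p (m - 1)) v) (hne : ∀ i < m, p i ≠ v) :
    IsPathSeq G (m + 1) fun i => if i < m then p i else v := by
  constructor
  · intro i hi
    dsimp only
    rw [if_pos (show i < m by omega)]
    split_ifs with h
    · exact hp.1 i h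
    · rwa [show i = m - 1 by omega]
  · intro i hi j hj h
    dsimp only at h
    split_ifs at h with h1 h2 h2
    · exact hp.2 i h1 j h2 h
    · exact absurd h (hne i h1)
    · exact absurd h.symm (hne j h2)
    · omega

theorem CycleSystem.isPathSeq_arc (h : CycleSystem G c) (j : Fin s) (x : ZMod (k j)) {m : ℕ}
    (hm : m ≤ k j) : IsPathSeq G m fun i => c j (x + i) := by
  constructor
  · intro i _
    dsimp only
    rw [Nat.cast_succ, ← add_assoc]
    exact h.adj j _
  · intro a ha b hb hab
    have h1 := add_left_cancel (h.injective j hab)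
    rw [ZMod.natCast_eq_natCast_iff'] at h1
    rwa [Nat.mod_eq_of_lt (by omega), Nat.mod_eq_of_lt (by omega)] at h1

theorem cast_self_sub {n m : ℕ} (h : m ≤ n) : ((n - m : ℕ) : ZMod n) = -m := by
  rw [Nat.cast_sub h, ZMod.natCast_self, zero_sub]

section Step

variable [Fintype V] (hk : ∀ i, 3 ≤ k i) (h : CycleSystem G c)
include hk h

/-- The path may use vertices of `c j` itself, because that cycle is the one replaced; the others
are kept. -/
theorem CycleSystem.step_adj {j : Fin s} {p : ℕ → V} (hp : IsPathSeq G (k j) p)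
    (hd : ∀ m < k j, Outside c (p m) ∨ ∃ x, p m = c j x) :
    (step (cycles k) G).Adj (p 0) (p (k j - 1)) := by
  refine step_adj_of_isPathSeq hk hp c (fun i _ => h.adj i) (fun i _ i' _ => h.inj i i') ?_
  intro i hi x m hm heq
  rcases hd m hm with h1 | ⟨y, h1⟩
  · exact h1 i x heq
  · exact h.ne hi x y (heq.symm.trans h1)

/-- Close up `u` followed by the arc of `k j - 1` vertices starting at `x`, which ends at `x - 2`.
The next two rules are similar, with two outside vertices and an arc from `x` to `x - 3`. -/
theorem CycleSystem.step_adj_sub_two {u : V} (hu : Outside c u) {j : Fin s} {x : ZMod (k j)}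
    (hux : G.Adj u (c j x)) : (step (cycles k) G).Adj u (c j (x - 2)) := by
  have hkj := hk j
  have hp := (h.isPathSeq_arc j x (m := k j - 1) (by omega)).cons (u := u) (by simpa using hux)
    (fun i _ => hu j _)
  rw [show k j - 1 + 1 = k j by omega] at hp
  have := h.step_adj hk hp ?_
  · rw [show k j - 1 = k j - 2 + 1 by omega, consSeq_succ, cast_self_sub (by omega)] at this
    simpa [sub_eq_add_neg] using this
  · rintro (_ | m) _
    · exact Or.inl hu
    · exact Or.inr ⟨_, rfl⟩

theorem CycleSystem.step_adj_sub_three {u v : V} (hu : Outside c u) (hv : Outside c v)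
    (huv : G.Adj u v) {j : Fin s} {x : ZMod (k j)} (hvx : G.Adj v (c j x)) :
    (step (cycles k) G).Adj u (c j (x - 3)) := by
  have hkj := hk j
  have hp := ((h.isPathSeq_arc j x (m := k j - 2) (by omega)).cons (u := v) (by simpa using hvx)
    (fun i _ => hv j _)).cons (u := u) (by simpa using huv) (by
      rintro (_ | i) _
      · exact huv.ne
      · exact hu j _)
  rw [show k j - 2 + 1 + 1 = k j by omega] at hp
  have := h.step_adj hk hp ?_
  · rw [show k j - 1 = k j - 3 + 1 + 1 by omega, consSeq_succ, consSeq_succ,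
      cast_self_sub (by omega)] at this
    simpa [sub_eq_add_neg] using this
  · rintro (_ | _ | m) _
    · exact Or.inl hu
    · exact Or.inl hv
    · exact Or.inr ⟨_, rfl⟩

theorem CycleSystem.step_adj_of_adj_sub_three {u v : V} (hu : Outside c u) (hv : Outside c v)
    (huv : u ≠ v) {j : Fin s} {x : ZMod (k j)} (hux : G.Adj u (c j x))
    (hvx : G.Adj v (c j (x - 3))) : (step (cycles k) G).Adj u v := by
  have hkj := hk j
  have hp := ((h.isPathSeq_arc j x (m := k j - 2) (by omega)).snoc (v := v) (by
    rw [show k j - 2 - 1 = k j - 3 by omega, cast_self_sub (by omega)]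
    simpa [sub_eq_add_neg] using hvx.symm) (fun i _ => (hv j _).symm)).cons (u := u)
      (by simpa [show 0 < k j - 2 by omega] using hux) (by
      intro i _
      split_ifs
      · exact hu j _
      · exact huv)
  rw [show k j - 2 + 1 + 1 = k j by omega] at hp
  have := h.step_adj hk hp ?_
  · rw [show k j - 1 = k j - 2 + 1 by omega, consSeq_succ, if_neg (by omega)] at this
    simpa using this
  · rintro (_ | m) _
    · exact Or.inl hu
    · rw [consSeq_succ]
      split_ifs
      · exact Or.inr ⟨_, rfl⟩
      · exact Or.inl hv

/-- Exchanging a vertex between two cycles. -/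
theorem CycleSystem.step_adj_of_exchange {i j : Fin s} (hij : i ≠ j) (hi : 4 ≤ k i) (hj : 4 ≤ k j)
    {a₁ a₂ a₃ v : V} (h1 : Outside c a₁) (h2 : Outside c a₂) (h3 : Outside c a₃)
    (hv : Outside c v) (h12 : a₁ ≠ a₂) (h13 : a₁ ≠ a₃) (h23 : a₂ ≠ a₃) (hv1 : v ≠ a₁)
    (hv2 : v ≠ a₂) (hv3 : v ≠ a₃) {x : ZMod (k i)} {y : ZMod (k j)}
    (h1x : G.Adj a₁ (c i (x + 2))) (h2x : G.Adj a₂ (c i (x - 2))) (h3x : G.Adj a₃ (c i x))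
    (h1y : G.Adj a₁ (c j y)) (h2y : G.Adj a₂ (c j y)) (h3y : G.Adj a₃ (c j (y + 2)))
    (hvx : G.Adj v (c i x)) : (step (cycles k) G).Adj v (c j (y - 2)) := by
  classical
  have hsmall : ∀ m : ℕ, 0 < m → m < 4 → (m : ZMod (k i)) ≠ 0 := by
    intro m h0 h4 h
    rw [ZMod.natCast_eq_zero_iff] at h
    exact absurd (Nat.le_of_dvd h0 h) (by omega)
  have n1 : (1 : ZMod (k i)) ≠ 0 := by simpa using hsmall 1 (by omega) (by omega)
  have n2 : (2 : ZMod (k i)) ≠ 0 := by simpa using hsmall 2 (by omega) (by omega)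
  have n3 : (3 : ZMod (k i)) ≠ 0 := by simpa using hsmall 3 (by omega) (by omega)
  -- In the cycle `c i` the stretch `x - 1, x, x + 1` is replaced by `a₂, c j y, a₁`. This frees `c
  -- i x` at the price of `c j y`.
  set g : ZMod (k i) → V := fun z =>
    if z = x then c j y else if z = x + 1 then a₁ else if z = x - 1 then a₂ else c i z with hg
  have gx : g x = c j y := if_pos rfl
  have gx1 : g (x + 1) = a₁ := by
    simp only [hg]
    rw [if_neg (by simpa using n1)]
    simp
  have gxm : g (x - 1) = a₂ := by
    simp only [hg]
    rw [if_neg (by simpa using n1), if_neg]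
    · simp
    intro h
    exact n2 (by linear_combination -h)
  have gz : ∀ z, z ≠ x → z ≠ x + 1 → z ≠ x - 1 → g z = c i z := by
    intro z hz1 hz2 hz3
    simp only [hg]
    rw [if_neg hz1, if_neg hz2, if_neg hz3]
  have gcases : ∀ z, g z = c j y ∨ g z = a₁ ∨ g z = a₂ ∨ (g z = c i z ∧ z ≠ x) := by
    intro z
    by_cases hz1 : z = x
    · left; rw [hz1, gx]
    by_cases hz2 : z = x + 1
    · right; left; rw [hz2, gx1]
    by_cases hz3 : z = x - 1
    · right; right; left; rw [hz3, gxm]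
    · right; right; right; exact ⟨gz z hz1 hz2 hz3, hz1⟩
  have ginj : Function.Injective g := by
    intro z w hzw
    simp only [hg] at hzw
    split_ifs at hzw with e1 e2 e3 e4 e5 e6 e7 e8 e9 e10 e11 e12 e13 e14 e15
    · rw [e1, e2]
    · exact absurd hzw.symm (h1 _ _)
    · exact absurd hzw.symm (h2 _ _)
    · exact absurd hzw.symm (h.ne hij _ _)
    · exact absurd hzw (h1 _ _)
    · rw [e5, e7]
    · exact absurd hzw h12
    · exact absurd hzw (h1 _ _)
    · exact absurd hzw (h2 _ _)
    · exact absurd hzw.symm h12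
    · rw [e9, e12]
    · exact absurd hzw (h2 _ _)
    · exact absurd hzw (h.ne hij _ _)
    · exact absurd hzw.symm (h1 _ _)
    · exact absurd hzw.symm (h2 _ _)
    · exact h.injective i hzw
  have gadj : ∀ z, G.Adj (g z) (g (z + 1)) := by
    intro z
    by_cases hz1 : z = x
    · rw [hz1, gx, gx1]; exact h1y.symm
    by_cases hz2 : z = x + 1
    · rw [hz2, gx1, gz]
      · rwa [add_assoc, one_add_one_eq_two]
      · intro h; exact n2 (by linear_combination h)
      · intro h; exact n1 (by linear_combination h)
      · intro h; exact n3 (by linear_combination h)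
    by_cases hz3 : z = x - 1
    · rw [hz3, gxm, sub_add_cancel, gx]; exact h2y
    by_cases hz4 : z = x - 2
    · rw [show z + 1 = x - 1 by rw [hz4]; ring, gxm, gz z hz1 hz2 hz3, hz4]
      exact h2x.symm
    · rw [gz z hz1 hz2 hz3, gz]
      · exact h.adj i z
      · intro h; exact hz3 (by linear_combination h)
      · intro h; exact hz1 (by linear_combination h)
      · intro h; exact hz4 (by linear_combination h)
  -- The path `v, c i x, a₃` followed by the arc of `c j` from `y + 2` to `y - 2` has `k j` vertices
  -- and avoids the modified cycle, since the arc misses `c j y`.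
  have hp := (((h.isPathSeq_arc j (y + 2) (m := k j - 3) (by omega)).cons (u := a₃)
    (by simpa using h3y) (fun m _ => h3 j _)).cons (u := c i x) (by simpa using h3x.symm) (by
      rintro (_ | m) _
      · exact (h3 _ _).symm
      · exact h.ne hij _ _)).cons (u := v) (by simpa using hvx) (by
      rintro (_ | _ | m) _
      · exact hv _ _
      · exact hv3
      · exact hv j _)
  rw [show k j - 3 + 1 + 1 + 1 = k j by omega] at hp
  have := step_adj_of_isPathSeq hk hp (Function.update c i g) ?_ ?_ ?_
  · rw [show k j - 1 = k j - 4 + 1 + 1 + 1 by omega, consSeq_succ, consSeq_succ, consSeq_succ,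
      consSeq_zero, cast_self_sub (by omega)] at this
    rwa [show y + 2 + -((4 : ℕ) : ZMod (k j)) = y - 2 by push_cast; ring] at this
  · intro l hl z
    by_cases hli : l = i
    · subst hli
      simpa only [Function.update_self] using gadj z
    · simpa only [Function.update_of_ne hli] using h.adj l z
  · intro l hl l' hl' z w hzw
    by_cases hli : l = i <;> by_cases hli' : l' = i
    · subst hli; subst hli'
      simp only [Function.update_self] at hzw
      rw [ginj hzw]
    · subst hli
      rw [Function.update_self, Function.update_of_ne hli'] at hzw
      rcases gcases z with e | e | e | ⟨e, -⟩ <;> rw [e] at hzw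
      · exact absurd hzw.symm (h.ne hl' _ _)
      · exact absurd hzw (h1 _ _)
      · exact absurd hzw (h2 _ _)
      · exact h.inj _ _ _ _ hzw
    · subst hli'
      rw [Function.update_self, Function.update_of_ne hli] at hzw
      rcases gcases w with e | e | e | ⟨e, -⟩ <;> rw [e] at hzw
      · exact absurd hzw (h.ne hl _ _)
      · exact absurd hzw.symm (h1 _ _)
      · exact absurd hzw.symm (h2 _ _)
      · exact h.inj _ _ _ _ hzw
    · rw [Function.update_of_ne hli, Function.update_of_ne hli'] at hzw
      exact h.inj _ _ _ _ hzw
  · intro l hl z m hm heq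
    by_cases hli : l = i
    · subst hli
      rw [Function.update_self] at heq
      rcases m with _ | _ | _ | m
      · rcases gcases z with e | e | e | ⟨e, -⟩ <;> rw [e] at heq
        · exact hv _ _ heq
        · exact hv1 heq
        · exact hv2 heq
        · exact hv _ _ heq
      · simp only [consSeq_succ, consSeq_zero] at heq
        rcases gcases z with e | e | e | ⟨e, hz⟩ <;> rw [e] at heq
        · exact h.ne hij _ _ heq
        · exact h1 _ _ heq.symm
        · exact h2 _ _ heq.symm
        · exact hz (h.injective l heq).symm
      · simp only [consSeq_succ, consSeq_zero] at heq
        rcases gcases z with e | e | e | ⟨e, -⟩ <;> rw [e] at heq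
        · exact h3 _ _ heq
        · exact h13 heq.symm
        · exact h23 heq.symm
        · exact h3 _ _ heq
      · simp only [consSeq_succ] at heq
        rcases gcases z with e | e | e | ⟨e, -⟩ <;> rw [e] at heq
        · have h5 := h.injective j heq
          have h6 : ((m + 2 : ℕ) : ZMod (k j)) = 0 := by
            push_cast
            linear_combination h5
          rw [ZMod.natCast_eq_zero_iff] at h6
          exact absurd (Nat.le_of_dvd (by omega) h6) (by omega)
        · exact h1 _ _ heq.symm
        · exact h2 _ _ heq.symm
        · exact h.ne hij _ _ heq.symm
    · rw [Function.update_of_ne hli] at heq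
      rcases m with _ | _ | _ | m
      · exact hv _ _ heq
      · exact h.ne hli _ _ heq.symm
      · exact h3 _ _ heq
      · exact h.ne hl _ _ heq.symm

end Step

end Rules

/-! ### Shortening walks towards the cycles. -/

section Attachment

variable {V : Type*} {s : ℕ} {k : Fin s → ℕ} {c : ∀ j, ZMod (k j) → V}

/-- The vertex `u` lies outside the cycles and has a neighbour on the cycle `c j`. -/
def Attached (G : SimpleGraph V) (c : ∀ j, ZMod (k j) → V) (j : Fin s) (u : V) : Prop :=
  Outside c u ∧ ∃ x, G.Adj u (c j x)

/-- There is a walk of length `d` from `u` to one of the cycles. -/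
def ReachesIn (G : SimpleGraph V) (c : ∀ j, ZMod (k j) → V) (d : ℕ) (u : V) : Prop :=
  ∃ p : ℕ → V, p 0 = u ∧ (∃ j x, p d = c j x) ∧ ∀ i < d, G.Adj (p i) (p (i + 1))

theorem ReachesIn.mono {G G' : SimpleGraph V} (hle : G ≤ G') {d : ℕ} {u : V}
    (h : ReachesIn G c d u) : ReachesIn G' c d u := by
  obtain ⟨p, h0, hd, hp⟩ := h
  exact ⟨p, h0, hd, fun i hi => hle (hp i hi)⟩

/-- A walk of minimal length to the cycles repeats no vertex, since the segment between two visits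
could be excised, and meets the cycles only at its end. -/
theorem ReachesIn.exists_path {G : SimpleGraph V} {d : ℕ} {u : V} (h : ReachesIn G c d u) :
    ∃ e ≤ d, ∃ p : ℕ → V, p 0 = u ∧ (∃ j x, p e = c j x) ∧ IsPathSeq G (e + 1) p ∧
      ∀ i < e, Outside c (p i) := by
  classical
  have hex : ∃ e, ReachesIn G c e u := ⟨d, h⟩
  set e := Nat.find hex
  obtain ⟨p, h0, hd, hp⟩ := Nat.find_spec hex
  have hmin : ∀ m < e, ¬ ReachesIn G c m u := fun m hm => Nat.find_min hex hm
  refine ⟨e, Nat.find_min' hex h, p, h0, hd, ⟨fun i hi => hp i (by omega), ?_⟩, ?_⟩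
  · have key : ∀ i j, i < j → j ≤ e → p i ≠ p j := by
      intro i j hij hj heq
      refine hmin (e - (j - i)) (by omega) ⟨fun m => if m ≤ i then p m else p (m + (j - i)), ?_, ?_, ?_⟩
      · simpa using h0
      · dsimp only
        have : (if e - (j - i) ≤ i then p (e - (j - i)) else p (e - (j - i) + (j - i))) = p e := by
          split_ifs with h1
          · rw [show e - (j - i) = i by omega, heq, show e = j by omega]
          · rw [show e - (j - i) + (j - i) = e by omega]
        rw [this]
        exact hd
      · intro m hm
        dsimp only
        split_ifs with h1 h2 h2
        · exact hp m (by omega)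
        · rw [show m = i by omega, heq, show i + 1 + (j - i) = j + 1 by omega]
          exact hp j (by omega)
        · omega
        · rw [show m + 1 + (j - i) = m + (j - i) + 1 by omega]
          exact hp _ (by omega)
    intro i hi j hj heq
    rcases lt_trichotomy i j with h1 | h1 | h1
    · exact absurd heq (key i j h1 (by omega))
    · exact h1
    · exact absurd heq.symm (key j i h1 (by omega))
  · intro i hi j x heq
    exact hmin i hi ⟨p, h0, ⟨j, x, heq⟩, fun m hm => hp m (by omega)⟩

theorem reachesIn_of_reachable [Fintype V] {G : SimpleGraph V} {u : V} {j : Fin s}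
    {x : ZMod (k j)} (h : G.Reachable u (c j x)) : ∃ d ≤ Fintype.card V, ReachesIn G c d u := by
  classical
  obtain ⟨w, hw⟩ := h.exists_isPath
  refine ⟨w.length, hw.length_lt.le, w.getVert, by simp, ⟨j, x, by simp⟩, fun i hi => ?_⟩
  exact w.adj_getVert_succ hi

/-- Stretches of `b` edges among outside vertices each become one edge. Subtracting `b + 1` absorbs
the uncontracted remainder, so that the truncated excess is divided by `b` in every step, without an
accumulating error. -/
theorem ReachesIn.step_contract [Fintype V] {G : SimpleGraph V} (hk : ∀ i, 3 ≤ k i)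
    (h : CycleSystem G c) {b : ℕ} {j₀ : Fin s} (hb : k j₀ = b + 1) {d : ℕ} {u : V}
    (hu : ReachesIn G c d u) :
    ∃ d', ReachesIn (step (cycles k) G) c d' u ∧ (d' - (b + 1)) * b ≤ d - (b + 1) := by
  have hk0 := hk j₀
  obtain ⟨e, hed, p, h0, hend, hp, hout⟩ := hu.exists_path
  rcases Nat.eq_zero_or_pos e with rfl | he
  · exact ⟨0, ⟨p, h0, hend, fun i hi => absurd hi (by omega)⟩, by simp⟩
  -- Only the first `e - 1` edges are contracted: the end of the path lies on a cycle, possibly one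
  -- that must be kept.
  set q := (e - 1) / b
  set r := (e - 1) % b
  have hqr : b * q + r = e - 1 := Nat.div_add_mod _ _
  have hr : r < b := Nat.mod_lt _ (by omega)
  refine ⟨q + r + 1, ⟨fun m => if m ≤ q then p (m * b) else p (q * b + (m - q)), ?_, ?_, ?_⟩, ?_⟩
  · simpa using h0
  · dsimp only
    rw [if_neg (by omega), show q * b + (q + r + 1 - q) = e by
      rw [mul_comm]; omega]
    exact hend
  · intro m hm
    dsimp only
    have hle : G ≤ step (cycles k) G := fun _ _ h => Or.inl h
    rcases Nat.lt_or_ge m q with hmq | hmq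
    · rw [if_pos (by omega), if_pos (by omega)]
      have hbound : (m + 1) * b ≤ e - 1 := by
        calc (m + 1) * b ≤ q * b := Nat.mul_le_mul_right _ hmq
          _ ≤ e - 1 := by rw [mul_comm]; omega
      have hexp : (m + 1) * b = m * b + b := by ring
      have := h.step_adj hk (j := j₀) (p := fun i => p (m * b + i)) ⟨?_, ?_⟩ ?_
      · rw [hb] at this
        simpa [hexp] using this
      · intro i hi
        exact hp.1 _ (by omega)
      · intro i hi i' hi' hii
        have := hp.2 _ (by omega) _ (by omega) hii
        omega
      · intro i hi
        exact Or.inl (hout _ (by omega))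
    · rw [if_neg (show ¬ m + 1 ≤ q by omega)]
      have hqm : q * b = b * q := mul_comm _ _
      have h1 : (if m ≤ q then p (m * b) else p (q * b + (m - q))) = p (q * b + (m - q)) := by
        split_ifs with h2
        · rw [show m = q by omega, Nat.sub_self, Nat.add_zero]
        · rfl
      rw [h1, show q * b + (m + 1 - q) = q * b + (m - q) + 1 by omega]
      exact hle (hp.1 _ (by omega))
  · rcases Nat.lt_or_ge (q + r) b with h1 | h1
    · rw [show q + r + 1 - (b + 1) = 0 by omega]
      simp
    · have hq : 1 ≤ q := by omega
      have hbq : b ≤ b * q := Nat.le_mul_of_pos_right _ hq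
      obtain ⟨y, hy⟩ : ∃ y, b = r + y := ⟨b - r, by omega⟩
      obtain ⟨z, hz⟩ : ∃ z, q = y + z := ⟨q - y, by omega⟩
      rw [show q + r + 1 - (b + 1) = z by omega]
      have h2 : b * q = b * y + z * b := by rw [hz]; ring
      have h3 : 1 ≤ y := by omega
      have h4 : b + y ≤ b * y + r + 1 := by
        nlinarith
      have : z * b + b ≤ e - 1 := by
        have : b ≤ b * y + r := by nlinarith
        omega
      omega

/-- This deals with the bounded excess left by contraction. A path shorter than `k j` is prolonged
along the cycle it hits and closed up, which attaches `u` directly; a longer one has its first `k j`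
vertices, all outside, closed up. -/
theorem ReachesIn.step_pred [Fintype V] {G : SimpleGraph V} (hk : ∀ i, 3 ≤ k i)
    (h : CycleSystem G c) {m : ℕ} (hm : 1 ≤ m) {u : V} (hu : ∃ d ≤ m + 1, ReachesIn G c d u) :
    ∃ d ≤ m, ReachesIn (step (cycles k) G) c d u := by
  have hle : G ≤ step (cycles k) G := fun _ _ h => Or.inl h
  obtain ⟨d, hd, hu⟩ := hu
  obtain ⟨e, hed, p, h0, ⟨j, x, hend⟩, hp, hout⟩ := hu.exists_path
  have hkj := hk j
  rcases Nat.lt_or_ge m e with hem | hem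
  swap
  · exact ⟨e, hem, p, h0, ⟨j, x, hend⟩, fun i hi => hle (hp.1 i (by omega))⟩
  rcases Nat.lt_or_ge e (k j) with hek | hek
  · have := h.step_adj hk (j := j) (p := fun i => if i < e then p i else c j (x + (i - e : ℕ)))
      ⟨?_, ?_⟩ ?_
    · rw [if_pos (by omega), if_neg (by omega), h0] at this
      refine ⟨1, hm, consSeq u (fun _ => c j (x + (k j - 1 - e : ℕ))), rfl, ⟨j, _, rfl⟩, ?_⟩
      intro i hi
      obtain rfl : i = 0 := by omega
      exact this
    · intro i hi
      dsimp only
      rcases lt_trichotomy (i + 1) e with h1 | h1 | h1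
      · rw [if_pos (by omega), if_pos h1]
        exact hp.1 i (by omega)
      · rw [if_pos (by omega), if_neg (by omega), h1, Nat.sub_self, Nat.cast_zero, add_zero, ← hend,
          ← h1]
        exact hp.1 i (by omega)
      · rw [if_neg (by omega), if_neg (by omega), show i + 1 - e = i - e + 1 by omega,
          Nat.cast_succ, ← add_assoc]
        exact h.adj j _
    · intro i hi i' hi' heq
      dsimp only at heq
      split_ifs at heq with h1 h2 h2
      · exact hp.2 i (by omega) i' (by omega) heq
      · exact absurd heq (hout i h1 _ _)
      · exact absurd heq.symm (hout i' h2 _ _)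
      · have := (h.isPathSeq_arc j x le_rfl).2 (i - e) (by omega) (i' - e) (by omega) heq
        omega
    · intro i hi
      split_ifs with h1
      · exact Or.inl (hout i h1)
      · exact Or.inr ⟨_, rfl⟩
  · have := h.step_adj hk (j := j) (p := p)
      ⟨fun i hi => hp.1 i (by omega), fun i hi i' hi' => hp.2 i (by omega) i' (by omega)⟩
      (fun i hi => Or.inl (hout i (by omega)))
    refine ⟨e - (k j - 1) + 1, by omega, consSeq u (fun i => p (k j - 1 + i)), rfl,
      ⟨j, x, ?_⟩, ?_⟩
    · rw [consSeq_succ, ← hend]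
      congr 1
      omega
    · rintro (_ | i) hi
      · rw [← h0]
        exact this
      · exact hle (hp.1 _ (by omega))

end Attachment

/-! ### The rules along the process, and attachment after logarithmic time. -/

section Time

variable {V : Type*} [Fintype V] {s : ℕ} {k : Fin s → ℕ} {c : ∀ j, ZMod (k j) → V}
  {G : SimpleGraph V}

theorem process_adj_mono {t T : ℕ} (hT : t ≤ T) {u v : V} (h : (process (cycles k) G t).Adj u v) :
    (process (cycles k) G T).Adj u v :=
  process_mono (cycles k) G hT h

theorem Attached.mono {j : Fin s} {u : V} {t T : ℕ} (hT : t ≤ T)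
    (h : Attached (process (cycles k) G t) c j u) : Attached (process (cycles k) G T) c j u :=
  ⟨h.1, h.2.imp fun _ hx => process_adj_mono hT hx⟩

/-- For odd `n` every element is even, so phrasing parity by `Even` in `ZMod n` treats odd and even
cycles together. -/
theorem even_or_even_add_one {n : ℕ} (w : ZMod n) : Even w ∨ Even (w + 1) := by
  obtain ⟨z, rfl⟩ := ZMod.intCast_surjective w
  rcases Int.even_or_odd z with h | h
  · exact Or.inl (h.map (Int.castRingHom (ZMod n)))
  · right
    have := (h.add_odd odd_one).map (Int.castRingHom (ZMod n))
    simpa using this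

variable (hk : ∀ i, 3 ≤ k i) {τ : ℕ} (h : CycleSystem (process (cycles k) G τ) c)
include hk h

omit hk in
theorem cycleSystem_process {t : ℕ} (ht : τ ≤ t) : CycleSystem (process (cycles k) G t) c :=
  h.mono (process_mono _ _ ht)

theorem process_adj_sub_three {u v : V} (hu : Outside c u) (hv : Outside c v) {t T : ℕ}
    (ht : τ ≤ t) (hT : t + 1 ≤ T) (huv : (process (cycles k) G t).Adj u v) {j : Fin s}
    {x : ZMod (k j)} (hvx : (process (cycles k) G t).Adj v (c j x)) :
    (process (cycles k) G T).Adj u (c j (x - 3)) :=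
  process_adj_mono hT ((cycleSystem_process h ht).step_adj_sub_three hk hu hv huv hvx)

theorem process_adj_of_adj_sub_three {u v : V} (hu : Outside c u) (hv : Outside c v) {t T : ℕ}
    (ht : τ ≤ t) (hT : t + 1 ≤ T) (huv : u ≠ v) {j : Fin s} {x : ZMod (k j)}
    (hux : (process (cycles k) G t).Adj u (c j x))
    (hvx : (process (cycles k) G t).Adj v (c j (x - 3))) : (process (cycles k) G T).Adj u v :=
  process_adj_mono hT ((cycleSystem_process h ht).step_adj_of_adj_sub_three hk hu hv huv hux hvx)

/-- The neighbourhood of an outside vertex on a cycle spreads over its parity class. -/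
theorem process_adj_of_even {u : V} (hu : Outside c u) {t T : ℕ} (ht : τ ≤ t) {j : Fin s}
    (hT : t + (k j - 1) ≤ T) {x y : ZMod (k j)} (hux : (process (cycles k) G t).Adj u (c j x))
    (hxy : Even (x - y)) : (process (cycles k) G T).Adj u (c j y) := by
  have hkj := hk j
  have : NeZero (k j) := ⟨by omega⟩
  have key : ∀ i : ℕ, (process (cycles k) G (t + i)).Adj u (c j (x - (2 * i : ℕ))) := by
    intro i
    induction i with
    | zero => simpa using hux
    | succ i ih =>
      have := (cycleSystem_process h (t := t + i) (by omega)).step_adj_sub_two hk hu ih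
      rw [show x - ((2 * (i + 1) : ℕ) : ZMod (k j)) = x - (2 * i : ℕ) - 2 by push_cast; ring]
      exact this
  obtain ⟨r, hr⟩ := hxy
  have := key r.val
  have hlt := ZMod.val_lt r
  rw [show x - ((2 * r.val : ℕ) : ZMod (k j)) = y by
    push_cast
    rw [ZMod.natCast_zmod_val]
    linear_combination hr] at this
  exact process_adj_mono (by omega) this

/-- If three vertices are attached to both of two cycles, then soon all vertices attached to one of
these cycles are attached to the other. -/
theorem attached_of_three {b : ℕ} (hb : ∀ i, k i ≤ b + 1) {i j : Fin s} (hij : i ≠ j) {t T : ℕ}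
    (ht : τ ≤ t) (hT : t + b + 4 ≤ T) {a₁ a₂ a₃ v : V} (h12 : a₁ ≠ a₂) (h13 : a₁ ≠ a₃)
    (h23 : a₂ ≠ a₃) (hi₁ : Attached (process (cycles k) G t) c i a₁)
    (hi₂ : Attached (process (cycles k) G t) c i a₂)
    (hi₃ : Attached (process (cycles k) G t) c i a₃)
    (hj₁ : Attached (process (cycles k) G t) c j a₁)
    (hj₂ : Attached (process (cycles k) G t) c j a₂)
    (hj₃ : Attached (process (cycles k) G t) c j a₃)
    (hv : Attached (process (cycles k) G t) c i v) : Attached (process (cycles k) G T) c j v := by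
  have hbi := hb i
  have hbj := hb j
  have hki := hk i
  have hkj := hk j
  -- If `v` stays unattached to `c j`, then it is adjacent to none of the `aᵢ`. This fixes all
  -- parities: on `c i` the `aᵢ` share the class of `x`, and on `c j` they share that of `a₁`. Both
  -- cycles are then even, and the exchange rule applies.
  by_contra hcon
  have hcon' : ∀ t' ≤ T, ∀ z, ¬ (process (cycles k) G t').Adj v (c j z) :=
    fun t' ht' z hz => hcon ⟨hv.1, z, process_adj_mono ht' hz⟩
  obtain ⟨hvo, x, hvx⟩ := hv
  obtain ⟨y, h1y⟩ := hj₁.2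
  have hne : ∀ a, Attached (process (cycles k) G t) c j a → v ≠ a := by
    rintro a ha rfl
    exact hcon (ha.mono (by omega))
  have hnadj : ∀ a, Attached (process (cycles k) G t) c j a →
      ¬ (process (cycles k) G (t + b + 3)).Adj v a := by
    rintro a ⟨hao, z, haz⟩ hva
    exact hcon' T le_rfl _ (process_adj_sub_three hk h hvo hao (t := t + b + 3) (by omega) (by omega)
      hva (process_adj_mono (by omega) haz))
  have hvx' : (process (cycles k) G (t + b)).Adj v (c i x) := process_adj_mono (by omega) hvx
  have hiEven : ∀ a, Attached (process (cycles k) G t) c i a →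
      Attached (process (cycles k) G t) c j a → ¬ Even (1 : ZMod (k i)) ∧
      ∀ z, Even (z - x) → (process (cycles k) G (t + b)).Adj a (c i z) := by
    rintro a ⟨hao, y', hay⟩ haj
    have hne' : ¬ Even (y' - (x - 3)) := by
      intro hev
      refine hnadj a haj (process_adj_of_adj_sub_three hk h hvo hao (t := t + b) (by omega)
        (by omega) (hne a haj) hvx' ?_)
      exact process_adj_of_even hk h hao ht (by omega) hay hev
    have hxy : Even (y' - x) := by
      rcases even_or_even_add_one (y' - (x - 3)) with h1 | h1
      · exact absurd h1 hne'
      · have : y' - x = (y' - (x - 3) + 1) - (2 + 2) := by ring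
        rw [this]
        exact h1.sub ⟨2, rfl⟩
    refine ⟨fun h1 => hne' ?_, fun z hz => process_adj_of_even hk h hao ht (by omega) hay ?_⟩
    · have : y' - (x - 3) = (y' - x) + 1 + (1 + 1) := by ring
      rw [this]
      exact (hxy.add h1).add ⟨1, rfl⟩
    · have : y' - z = (y' - x) - (z - x) := by ring
      rw [this]
      exact hxy.sub hz
  have hjEven : ∀ a, a₁ ≠ a → Attached (process (cycles k) G t) c i a →
      Attached (process (cycles k) G t) c j a → ¬ Even (1 : ZMod (k j)) ∧
      ∀ z, Even (z - y) → (process (cycles k) G (t + b)).Adj a (c j z) := by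
    rintro a hne1 hai ⟨hao, y', hay⟩
    have haj : Attached (process (cycles k) G t) c j a := ⟨hao, y', hay⟩
    have hne' : ¬ Even (y' - (y - 3)) := by
      intro hev
      have h1 := process_adj_of_adj_sub_three hk h hj₁.1 hao (t := t + b) (T := t + b + 1)
        (by omega) (by omega) hne1 (process_adj_mono (by omega) h1y)
        (process_adj_of_even hk h hao ht (by omega) hay hev)
      have h2 := process_adj_sub_three hk h hj₁.1 hao (t := t + b + 1) (T := t + b + 2)
        (by omega) (by omega) h1
        (process_adj_mono (by omega) ((hiEven a hai haj).2 x (by simp)))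
      exact hnadj a₁ hj₁ (process_adj_of_adj_sub_three hk h hvo hj₁.1 (t := t + b + 2) (by omega)
        (by omega) (hne a₁ hj₁) (process_adj_mono (by omega) hvx) h2)
    have hxy : Even (y' - y) := by
      rcases even_or_even_add_one (y' - (y - 3)) with h1 | h1
      · exact absurd h1 hne'
      · have : y' - y = (y' - (y - 3) + 1) - (2 + 2) := by ring
        rw [this]
        exact h1.sub ⟨2, rfl⟩
    refine ⟨fun h1 => hne' ?_, fun z hz => process_adj_of_even hk h hao ht (by omega) hay ?_⟩
    · have : y' - (y - 3) = (y' - y) + 1 + (1 + 1) := by ring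
      rw [this]
      exact (hxy.add h1).add ⟨1, rfl⟩
    · have : y' - z = (y' - y) - (z - y) := by ring
      rw [this]
      exact hxy.sub hz
  have hfour : ∀ n, 3 ≤ n → ¬ Even (1 : ZMod n) → 4 ≤ n := by
    intro n hn h1
    by_contra hlt
    obtain rfl : n = 3 := by omega
    -- In `ZMod 3` one has `1 = 2 + 2`, so triangles are excluded.
    exact h1 ⟨2, by decide⟩
  have h3 := (hiEven a₃ hi₃ hj₃).2
  refine hcon' (t + b + 1) (by omega) (y - 2)
    ((cycleSystem_process h (t := t + b) (by omega)).step_adj_of_exchange hk hij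
      (hfour _ hki (hiEven a₁ hi₁ hj₁).1) (hfour _ hkj (hjEven a₂ h12 hi₂ hj₂).1)
      hi₁.1 hi₂.1 hi₃.1 hvo h12 h13 h23 (hne _ hj₁) (hne _ hj₂) (hne _ hj₃)
      ((hiEven a₁ hi₁ hj₁).2 _ ⟨1, by ring⟩) ((hiEven a₂ hi₂ hj₂).2 _ ⟨-1, by ring⟩)
      ((hiEven a₃ hi₃ hj₃).2 _ (by simp)) (process_adj_mono (by omega) h1y)
      ((hjEven a₂ h12 hi₂ hj₂).2 _ (by simp)) ((hjEven a₃ h13 hi₃ hj₃).2 _ ⟨1, by ring⟩) hvx')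

/-- After a logarithmic number of steps, all vertices in the components of the cycles are attached
to the cycles. -/
theorem exists_attached_of_reachable {b : ℕ} {j₀ : Fin s} (hb : k j₀ = b + 1) {l : ℕ}
    (hl : Fintype.card V ≤ b ^ l) {u : V} {j : Fin s} {x : ZMod (k j)}
    (hu : (process (cycles k) G τ).Reachable u (c j x)) {T : ℕ} (hT : τ + l + b + 1 ≤ T) :
    ¬ Outside c u ∨ ∃ i, Attached (process (cycles k) G T) c i u := by
  have hkj := hk j₀
  have h1 : ∀ t, ∃ d, ReachesIn (process (cycles k) G (τ + t)) c d u ∧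
      (d - (b + 1)) * b ^ t ≤ Fintype.card V := by
    intro t
    induction t with
    | zero =>
      obtain ⟨d, hd, hu⟩ := reachesIn_of_reachable hu
      exact ⟨d, hu, by rw [pow_zero, mul_one]; omega⟩
    | succ t ih =>
      obtain ⟨d, hd, hdb⟩ := ih
      obtain ⟨d', hd', hdb'⟩ := hd.step_contract hk (cycleSystem_process h (by omega)) hb
      refine ⟨d', hd', ?_⟩
      calc (d' - (b + 1)) * b ^ (t + 1) = (d' - (b + 1)) * b * b ^ t := by ring
        _ ≤ (d - (b + 1)) * b ^ t := Nat.mul_le_mul_right _ hdb'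
        _ ≤ _ := hdb
  -- As `|V| ≤ b ^ l`, the excess over `b + 1` is now at most one.
  have h2 : ∃ d ≤ b + 2, ReachesIn (process (cycles k) G (τ + l)) c d u := by
    obtain ⟨d, hd, hdb⟩ := h1 l
    refine ⟨d, ?_, hd⟩
    have : (d - (b + 1)) * b ^ l ≤ 1 * b ^ l := by omega
    have := Nat.le_of_mul_le_mul_right this (Nat.pow_pos (by omega))
    omega
  have h3 : ∀ m ≤ b + 1, ∃ d ≤ b + 2 - m,
      ReachesIn (process (cycles k) G (τ + l + m)) c d u := by
    intro m hm
    induction m with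
    | zero => simpa using h2
    | succ m ih =>
      refine ReachesIn.step_pred hk (cycleSystem_process h (t := τ + l + m) (by omega)) (by omega) ?_
      rw [show b + 2 - (m + 1) + 1 = b + 2 - m by omega]
      exact ih (by omega)
  obtain ⟨d, hd, p, h0, ⟨i, z, hend⟩, hp⟩ := h3 (b + 1) le_rfl
  by_cases hout : Outside c u
  · right
    have hd1 : d = 1 := by
      by_contra hne
      obtain rfl : d = 0 := by omega
      exact hout i z (h0.symm.trans hend)
    subst hd1
    have := hp 0 (by omega)
    rw [h0, zero_add, hend] at this
    exact ⟨i, hout, z, process_adj_mono (by omega) this⟩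
  · exact Or.inl hout

end Time

/-! ### A bounded progress measure, and the structure while it is constant. -/

section TwinClasses

/-- Two vertices with the same neighbours apart from themselves. -/
def Twins {V : Type*} (G : SimpleGraph V) (u v : V) : Prop :=
  ∀ w, w ≠ u → w ≠ v → (G.Adj u w ↔ G.Adj v w)

theorem exists_eq_of_monotone_of_le {f : ℕ → ℕ} (hf : Monotone f) {M : ℕ} (hM : ∀ t, f t ≤ M)
    (T L : ℕ) : ∃ a ≤ M, f (T + a * L) = f (T + (a + 1) * L) := by
  by_contra! hcon
  have key : ∀ a ≤ M + 1, a ≤ f (T + a * L) := by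
    intro a ha
    induction a with
    | zero => simp
    | succ a ih =>
      have h1 := ih (by omega)
      have h2 := hcon a (by omega)
      have h3 : f (T + a * L) ≤ f (T + (a + 1) * L) :=
        hf (Nat.add_le_add_left (Nat.mul_le_mul_right _ (Nat.le_succ a)) T)
      omega
  have := key (M + 1) le_rfl
  have := hM (T + (M + 1) * L)
  omega

/-- The pairs `i < j` of indices. -/
def ltPairs (s : ℕ) : Finset (Fin s × Fin s) := univ.filter fun p => p.1 < p.2

theorem two_mul_card_ltPairs (s : ℕ) : 2 * #(ltPairs s) + s = s * s := by
  classical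
  have h1 : #(univ.filter fun p : Fin s × Fin s => p.2 < p.1) = #(ltPairs s) := by
    refine card_bij' (fun p _ => p.swap) (fun p _ => p.swap) ?_ ?_ ?_ ?_ <;> simp [ltPairs]
  have h2 : #(univ.filter fun p : Fin s × Fin s => p.1 = p.2) = s := by
    conv_rhs => rw [← Fintype.card_fin s]
    refine card_bij' (fun p _ => p.1) (fun i _ => (i, i)) ?_ ?_ ?_ ?_ <;> simp
  have h3 : #(univ : Finset (Fin s × Fin s)) = s * s := by simp
  have h4 : (univ : Finset (Fin s × Fin s)) = ltPairs s ∪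
      ((univ.filter fun p => p.2 < p.1) ∪ univ.filter fun p => p.1 = p.2) := by
    ext ⟨i, j⟩
    simp only [ltPairs, mem_univ, mem_union, mem_filter, true_and, true_iff]
    rcases lt_trichotomy i j with h | h | h <;> simp [h]
  rw [← h3, h4, card_union_of_disjoint, card_union_of_disjoint, h1, h2]
  · omega
  · rw [disjoint_filter]
    intro p _ h h'
    exact h.ne' h'
  · rw [ltPairs, disjoint_union_right, disjoint_filter, disjoint_filter]
    refine ⟨?_, ?_⟩
    · rintro ⟨i, j⟩ - h h'
      exact lt_asymm h h'
    · intro p _ h h'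
      exact h.ne h'

variable {V : Type*} [Fintype V] {s : ℕ} {k : Fin s → ℕ} {c : ∀ j, ZMod (k j) → V}
  {G : SimpleGraph V}

open Classical in
/-- The vertices attached to `c j` after `t` steps. -/
noncomputable def attachedSet (G : SimpleGraph V) (c : ∀ j, ZMod (k j) → V) (t : ℕ) (j : Fin s) :
    Finset V :=
  univ.filter fun u => Attached (process (cycles k) G t) c j u

theorem mem_attachedSet {t : ℕ} {j : Fin s} {u : V} :
    u ∈ attachedSet G c t j ↔ Attached (process (cycles k) G t) c j u := by
  simp [attachedSet]

theorem attachedSet_mono {t T : ℕ} (hT : t ≤ T) (j : Fin s) :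
    attachedSet G c t j ⊆ attachedSet G c T j := by
  intro u
  rw [mem_attachedSet, mem_attachedSet]
  exact Attached.mono hT

/-- Some vertex is attached to all vertices of `c j`. -/
def HasFull (G : SimpleGraph V) (c : ∀ j, ZMod (k j) → V) (t : ℕ) (j : Fin s) : Prop :=
  ∃ u, Outside c u ∧ ∀ x, (process (cycles k) G t).Adj u (c j x)

theorem HasFull.mono {t T : ℕ} (hT : t ≤ T) {j : Fin s} (h : HasFull G c t j) :
    HasFull G c T j := by
  obtain ⟨u, hu, hx⟩ := h
  exact ⟨u, hu, fun x => process_adj_mono hT (hx x)⟩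

open Classical in
/-- A bounded monotone quantity that measures the progress of the process near the cycles. -/
noncomputable def progress (G : SimpleGraph V) (c : ∀ j, ZMod (k j) → V) (t : ℕ) : ℕ :=
  ∑ p ∈ ltPairs s, min 3 #(attachedSet G c t p.1 ∩ attachedSet G c t p.2) +
    ∑ j, if HasFull G c t j then 1 else 0

theorem progress_le (t : ℕ) : progress G c t ≤ 3 * #(ltPairs s) + s := by
  classical
  unfold progress
  refine Nat.add_le_add ?_ ?_
  · refine (sum_le_card_nsmul _ _ 3 fun p _ => min_le_left _ _).trans ?_
    rw [smul_eq_mul, mul_comm]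
  · refine (sum_le_card_nsmul _ _ 1 fun j _ => ?_).trans ?_
    · split_ifs <;> omega
    · simp

open Classical in
theorem min_card_inter_mono {t T : ℕ} (hT : t ≤ T) (i j : Fin s) :
    min 3 #(attachedSet G c t i ∩ attachedSet G c t j) ≤
      min 3 #(attachedSet G c T i ∩ attachedSet G c T j) :=
  min_le_min le_rfl
    (card_le_card (inter_subset_inter (attachedSet_mono hT i) (attachedSet_mono hT j)))

open Classical in
theorem ite_hasFull_mono {t T : ℕ} (hT : t ≤ T) (j : Fin s) :
    (if HasFull G c t j then 1 else 0) ≤ if HasFull G c T j then 1 else 0 := by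
  split_ifs with h1 h2
  · exact le_rfl
  · exact absurd (h1.mono hT) h2
  · exact Nat.zero_le _
  · exact le_rfl

theorem progress_mono : Monotone (progress G c) := by
  classical
  intro t T hT
  unfold progress
  refine Nat.add_le_add (sum_le_sum fun p _ => ?_) (sum_le_sum fun j _ => ite_hasFull_mono hT j)
  exact min_card_inter_mono hT p.1 p.2

open Classical in
theorem min_card_inter_eq_of_progress_eq {t T : ℕ} (hT : t ≤ T)
    (h : progress G c t = progress G c T) {i j : Fin s} (hij : i ≠ j) :
    min 3 #(attachedSet G c t i ∩ attachedSet G c t j) =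
      min 3 #(attachedSet G c T i ∩ attachedSet G c T j) := by
  have h1 : ∑ p ∈ ltPairs s, min 3 #(attachedSet G c t p.1 ∩ attachedSet G c t p.2) ≤
      ∑ p ∈ ltPairs s, min 3 #(attachedSet G c T p.1 ∩ attachedSet G c T p.2) :=
    sum_le_sum fun p _ => min_card_inter_mono hT p.1 p.2
  have h2 : (∑ j, if HasFull G c t j then 1 else 0) ≤ ∑ j, if HasFull G c T j then 1 else 0 :=
    sum_le_sum fun j _ => ite_hasFull_mono hT j
  have h3 : ∑ p ∈ ltPairs s, min 3 #(attachedSet G c t p.1 ∩ attachedSet G c t p.2) =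
      ∑ p ∈ ltPairs s, min 3 #(attachedSet G c T p.1 ∩ attachedSet G c T p.2) := by
    refine le_antisymm h1 ?_
    unfold progress at h
    omega
  have h4 := (sum_eq_sum_iff_of_le fun p _ => min_card_inter_mono hT p.1 p.2).1 h3
  rcases lt_or_gt_of_ne hij with hlt | hlt
  · exact h4 (i, j) (by simp [ltPairs, hlt])
  · have := h4 (j, i) (by simp [ltPairs, hlt])
    simpa only [inter_comm] using this

/-- Each summand of `progress` is monotone, so equality of the sums forces equality term by term. -/
theorem hasFull_of_progress_eq {t T : ℕ} (hT : t ≤ T)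
    (h : progress G c t = progress G c T) {j : Fin s} (hj : HasFull G c T j) :
    HasFull G c t j := by
  classical
  have h1 : ∑ p ∈ ltPairs s, min 3 #(attachedSet G c t p.1 ∩ attachedSet G c t p.2) ≤
      ∑ p ∈ ltPairs s, min 3 #(attachedSet G c T p.1 ∩ attachedSet G c T p.2) :=
    sum_le_sum fun p _ => min_card_inter_mono hT p.1 p.2
  have h2 : (∑ j, if HasFull G c t j then 1 else 0) = ∑ j, if HasFull G c T j then 1 else 0 := by
    refine le_antisymm (sum_le_sum fun j _ => ite_hasFull_mono hT j) ?_
    unfold progress at h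
    omega
  have h4 := (sum_eq_sum_iff_of_le fun j _ => ite_hasFull_mono hT j).1 h2 j (mem_univ j)
  by_contra hn
  rw [if_neg hn, if_pos hj] at h4
  omega


section Quiet

variable (hk : ∀ i, 3 ≤ k i) {τ : ℕ} (h : CycleSystem (process (cycles k) G τ) c) {b : ℕ}
  (hb : ∀ i, k i ≤ b + 1)
include hk h hb

theorem attached_of_three_le_card {i j : Fin s} (hij : i ≠ j) {t T : ℕ} (ht : τ ≤ t)
    (hT : t + b + 4 ≤ T) [DecidableEq V] (hcard : 3 ≤ #(attachedSet G c t i ∩ attachedSet G c t j))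
    {v : V} (hv : Attached (process (cycles k) G t) c i v) :
    Attached (process (cycles k) G T) c j v := by
  obtain ⟨A, hA, hA3⟩ := exists_subset_card_eq hcard
  obtain ⟨a₁, a₂, a₃, h12, h13, h23, rfl⟩ := card_eq_three.1 hA3
  have hmem : ∀ a ∈ ({a₁, a₂, a₃} : Finset V), Attached (process (cycles k) G t) c i a ∧
      Attached (process (cycles k) G t) c j a := by
    intro a ha
    have := hA ha
    rwa [mem_inter, mem_attachedSet, mem_attachedSet] at this
  have m1 := hmem a₁ (by simp)
  have m2 := hmem a₂ (by simp)
  have m3 := hmem a₃ (by simp)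
  exact attached_of_three hk h hb hij ht hT h12 h13 h23 m1.1 m2.1 m3.1 m1.2 m2.2 m3.2 hv

/-- While the progress is constant, no new vertices become attached to a cycle. -/
theorem attached_of_progress_eq {T₁ : ℕ}
    (hT₁ : ∀ t i u, Attached (process (cycles k) G t) c i u →
      ∃ i', Attached (process (cycles k) G T₁) c i' u)
    {t₀ t₁ t₃ : ℕ} (h0 : τ ≤ t₀) (hT0 : T₁ ≤ t₀) (h01 : t₀ + b + 4 ≤ t₁) (h13 : t₁ ≤ t₃)
    (hprog : progress G c t₀ = progress G c t₃) {j : Fin s} {u : V}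
    (hu : Attached (process (cycles k) G t₃) c j u) :
    Attached (process (cycles k) G t₁) c j u := by
  classical
  obtain ⟨i, hi⟩ := hT₁ _ _ _ hu
  rcases eq_or_ne i j with rfl | hij
  · exact hi.mono (by omega)
  have hi0 := hi.mono hT0
  -- Below the cap `3`, a constant capped cardinality freezes the common set itself; at the cap, the
  -- three-vertex rule has already attached `u`.
  rcases Nat.lt_or_ge #(attachedSet G c t₀ i ∩ attachedSet G c t₀ j) 3 with hlt | hge
  · have heq := min_card_inter_eq_of_progress_eq (show t₀ ≤ t₃ by omega) hprog hij
    have hsub : attachedSet G c t₀ i ∩ attachedSet G c t₀ j ⊆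
        attachedSet G c t₃ i ∩ attachedSet G c t₃ j :=
      inter_subset_inter (attachedSet_mono (by omega) i) (attachedSet_mono (by omega) j)
    have heq' := eq_of_subset_of_card_le hsub (by omega)
    have hu3 : u ∈ attachedSet G c t₃ i ∩ attachedSet G c t₃ j :=
      mem_inter.2 ⟨mem_attachedSet.2 (hi0.mono (by omega)), mem_attachedSet.2 hu⟩
    rw [← heq', mem_inter, mem_attachedSet, mem_attachedSet] at hu3
    exact hu3.2.mono (by omega)
  · exact attached_of_three_le_card hk h hb hij h0 h01 hge hi0

-- A vertex `w` joined to the whole cycle acts as a hub: an attached `u` becomes adjacent to `w`,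
-- then through `w` to the whole cycle, and finally to every other attached vertex. This accounts
-- for the three steps.
omit hb in
theorem adj_of_hasFull {t₀ t₁ t₂ : ℕ} (h0 : τ ≤ t₀) (h01 : t₀ ≤ t₁) (h12 : t₁ + 3 ≤ t₂)
    {j : Fin s} (hj : HasFull G c t₀ j) :
    (∀ u, Attached (process (cycles k) G t₁) c j u → ∀ x,
      (process (cycles k) G t₂).Adj u (c j x)) ∧
    ∀ u v, Attached (process (cycles k) G t₁) c j u → Attached (process (cycles k) G t₁) c j v →
      u ≠ v → (process (cycles k) G t₂).Adj u v := by
  obtain ⟨w, hw, hwx⟩ := hj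
  have key : ∀ u, Attached (process (cycles k) G t₁) c j u → ∀ x,
      (process (cycles k) G (t₁ + 2)).Adj u (c j x) := by
    rintro u ⟨hu, y, huy⟩ x
    rcases eq_or_ne u w with rfl | huw
    · exact process_adj_mono (by omega) (hwx x)
    · have h1 := process_adj_of_adj_sub_three hk h hu hw (t := t₁) (T := t₁ + 1) (by omega) le_rfl
        huw huy (process_adj_mono h01 (hwx _))
      have h2 := process_adj_sub_three hk h hu hw (t := t₁ + 1) (T := t₁ + 2) (by omega) le_rfl
        h1 (process_adj_mono (by omega) (hwx (x + 3)))
      rwa [add_sub_cancel_right] at h2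
  refine ⟨fun u hu x => process_adj_mono (by omega) (key u hu x), fun u v hu hv huv => ?_⟩
  exact process_adj_of_adj_sub_three hk h hu.1 hv.1 (t := t₁ + 2) (by omega) (by omega) huv
    (key u hu 0) (key v hv _)

/-- If no vertex is attached to a whole cycle for a long time, then the graph near this cycle is
bipartite. -/
theorem adj_iff_of_not_hasFull {t₁ t₂ t₃ : ℕ} (h1 : τ ≤ t₁) (h12 : t₁ + b + 1 ≤ t₂)
    (h23 : t₂ + b + 1 ≤ t₃) {j : Fin s} (hj : ¬ HasFull G c t₃ j) {u v : V}
    (hu : Attached (process (cycles k) G t₁) c j u)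
    (hv : Attached (process (cycles k) G t₁) c j v) :
    (((process (cycles k) G t₂).Adj u (c j 0) ↔ (process (cycles k) G t₂).Adj v (c j 0)) →
      ∀ x, (process (cycles k) G t₂).Adj u (c j x) ↔ (process (cycles k) G t₂).Adj v (c j x)) ∧
    (u ≠ v → ((process (cycles k) G t₂).Adj u v ↔
      ¬ ((process (cycles k) G t₂).Adj u (c j 0) ↔ (process (cycles k) G t₂).Adj v (c j 0)))) := by
  have hbj := hb j
  have exact_of_adj : ∀ u, Outside c u → ∀ y, (process (cycles k) G t₁).Adj u (c j y) →
      ∀ t ≤ t₂ + 1, τ ≤ t → ∀ x, (process (cycles k) G t).Adj u (c j x) → Even (x - y) := by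
    intro u hu y huy t ht hτt x hux
    by_contra hxy
    -- Neighbours of both parities would spread over the whole cycle by time `t₃`.
    refine hj ⟨u, hu, fun z => ?_⟩
    rcases even_or_even_add_one (y - z) with hz | hz
    · exact process_adj_of_even hk h hu h1 (by omega) huy hz
    · refine process_adj_of_even hk h hu hτt (by omega) hux ?_
      obtain ⟨r, hr⟩ := hz
      obtain ⟨q, hq⟩ := (even_or_even_add_one (x - y)).resolve_left hxy
      exact ⟨r + q - 1, by linear_combination hr + hq⟩
  have adj_of_even : ∀ u, Outside c u → ∀ y, (process (cycles k) G t₁).Adj u (c j y) →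
      ∀ x, Even (x - y) → (process (cycles k) G (t₁ + b)).Adj u (c j x) := by
    intro u hu y huy x hxy
    refine process_adj_of_even hk h hu h1 (by omega) huy ?_
    rw [← neg_sub]
    exact hxy.neg
  obtain ⟨huo, y, huy⟩ := hu
  obtain ⟨hvo, z, hvz⟩ := hv
  have hiffu : ∀ x, (process (cycles k) G t₂).Adj u (c j x) ↔ Even (x - y) := fun x =>
    ⟨exact_of_adj u huo y huy t₂ (by omega) (by omega) x,
      fun hx => process_adj_mono (by omega) (adj_of_even u huo y huy x hx)⟩
  have hiffv : ∀ x, (process (cycles k) G t₂).Adj v (c j x) ↔ Even (x - z) := fun x =>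
    ⟨exact_of_adj v hvo z hvz t₂ (by omega) (by omega) x,
      fun hx => process_adj_mono (by omega) (adj_of_even v hvo z hvz x hx)⟩
  have hone : ¬ Even (1 : ZMod (k j)) := by
    rintro ⟨r, hr⟩
    refine hj ⟨u, huo, fun x => process_adj_mono (by omega) (adj_of_even u huo y huy x ?_)⟩
    exact ⟨(x - y) * r, by linear_combination (x - y) * hr⟩
  simp only [hiffu, hiffv]
  have hsame : (Even (0 - y) ↔ Even (0 - z)) → Even (y - z) := by
    intro hyz
    rcases even_or_even_add_one (0 - y) with ⟨r, hr⟩ | ⟨r, hr⟩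
    · obtain ⟨q, hq⟩ := hyz.1 ⟨r, hr⟩
      exact ⟨q - r, by linear_combination hq - hr⟩
    · have hny : ¬ Even (0 - y) := by
        rintro ⟨p, hp⟩
        exact hone ⟨r - p, by linear_combination hr - hp⟩
      obtain ⟨q, hq⟩ := (even_or_even_add_one (0 - z)).resolve_left fun hz => hny (hyz.2 hz)
      exact ⟨q - r, by linear_combination hq - hr⟩
  refine ⟨fun hyz x => ?_, fun huv => ⟨fun hadj hyz => ?_, fun hyz => ?_⟩⟩
  · obtain ⟨r, hr⟩ := hsame hyz
    constructor
    · rintro ⟨q, hq⟩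
      exact ⟨q + r, by linear_combination hq + hr⟩
    · rintro ⟨q, hq⟩
      exact ⟨q - r, by linear_combination hq - hr⟩
  · obtain ⟨r, hr⟩ := hsame hyz
    have := process_adj_sub_three hk h huo hvo (t := t₂) (T := t₂ + 1) (by omega) le_rfl hadj
      ((hiffv z).2 (by simp))
    obtain ⟨q, hq⟩ := exact_of_adj u huo y huy (t₂ + 1) le_rfl (by omega) _ this
    exact hone ⟨-q - r - 1, by linear_combination -hq - hr⟩
  · have hodd : Even (y - 3 - z) := by
      rcases even_or_even_add_one (y - 3 - z) with h' | ⟨r, hr⟩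
      · exact h'
      · refine absurd ⟨?_, ?_⟩ hyz
        · rintro ⟨q, hq⟩
          exact ⟨q + r + 1, by linear_combination hq + hr⟩
        · rintro ⟨q, hq⟩
          exact ⟨q - r - 1, by linear_combination hq - hr⟩
    refine process_adj_of_adj_sub_three hk h huo hvo (t := t₁ + b) (by omega) (by omega) huv
      (adj_of_even u huo y huy y (by simp)) (adj_of_even v hvo z hvz _ hodd)

end Quiet

end TwinClasses

/-! ### Bounding the number of twin classes near the cycles. -/

section Classes

variable {V : Type*} [Fintype V] {s : ℕ} {k : Fin s → ℕ} {c : ∀ j, ZMod (k j) → V}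
  {G : SimpleGraph V}

open Classical in
/-- The vertices on the cycles or attached to them after `t` steps. -/
noncomputable def nearSet (G : SimpleGraph V) (c : ∀ j, ZMod (k j) → V) (t : ℕ) : Finset V :=
  univ.filter fun u => ¬ Outside c u ∨ ∃ i, Attached (process (cycles k) G t) c i u

theorem mem_nearSet {t : ℕ} {u : V} :
    u ∈ nearSet G c t ↔ ¬ Outside c u ∨ ∃ i, Attached (process (cycles k) G t) c i u := by
  simp [nearSet]

open Classical in
theorem card_filter_not_outside_le (hk : ∀ i, 3 ≤ k i) :
    #(univ.filter fun u => ¬ Outside c u) ≤ ∑ i, k i := by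
  have : ∀ i, NeZero (k i) := fun i => ⟨by have := hk i; omega⟩
  have hsub : (univ.filter fun u => ¬ Outside c u) ⊆
      (univ : Finset (Σ i, ZMod (k i))).image fun z => c z.1 z.2 := by
    intro u hu
    simp only [Outside, mem_filter, mem_univ, true_and, not_forall, not_not] at hu
    obtain ⟨j, x, rfl⟩ := hu
    exact mem_image.2 ⟨⟨j, x⟩, mem_univ _, rfl⟩
  refine (card_le_card hsub).trans (card_image_le.trans ?_)
  rw [card_univ, Fintype.card_sigma]
  simp [ZMod.card]

open Classical in
/-- The vertices attached to two cycles that share at most two attached vertices. -/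
noncomputable def exceptionalSet (G : SimpleGraph V) (c : ∀ j, ZMod (k j) → V) (t : ℕ) :
    Finset V :=
  (ltPairs s).biUnion fun p =>
    if #(attachedSet G c t p.1 ∩ attachedSet G c t p.2) ≤ 2 then
      attachedSet G c t p.1 ∩ attachedSet G c t p.2 else ∅

theorem card_exceptionalSet_le (t : ℕ) : #(exceptionalSet G c t) ≤ #(ltPairs s) * 2 := by
  classical
  refine card_biUnion_le_card_mul _ _ _ fun p _ => ?_
  split_ifs with h
  · exact h
  · simp

open Classical in
theorem three_le_card_of_notMem_exceptionalSet {t : ℕ} {u : V} (hu : u ∉ exceptionalSet G c t)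
    {i j : Fin s} (hij : i ≠ j) (hi : Attached (process (cycles k) G t) c i u)
    (hj : Attached (process (cycles k) G t) c j u) :
    3 ≤ #(attachedSet G c t i ∩ attachedSet G c t j) := by
  by_contra hlt
  apply hu
  rcases lt_or_gt_of_ne hij with h | h
  · refine mem_biUnion.2 ⟨(i, j), by simp [ltPairs, h], ?_⟩
    rw [if_pos (by dsimp only; omega)]
    exact mem_inter.2 ⟨mem_attachedSet.2 hi, mem_attachedSet.2 hj⟩
  · refine mem_biUnion.2 ⟨(j, i), by simp [ltPairs, h], ?_⟩
    rw [if_pos (by dsimp only; rw [inter_comm]; omega)]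
    exact mem_inter.2 ⟨mem_attachedSet.2 hj, mem_attachedSet.2 hi⟩

/-- After a bounded number of further steps, the vertices near the cycles fall into a bounded number
of classes of twins. -/
theorem exists_twin_classes (hk : ∀ i, 3 ≤ k i) {τ : ℕ}
    (h : CycleSystem (process (cycles k) G τ) c) {b : ℕ} (hb : ∀ i, k i ≤ b + 1) (hb2 : 2 ≤ b)
    {T₁ : ℕ} (hτ : τ ≤ T₁)
    (hT₁ : ∀ t i u, Attached (process (cycles k) G t) c i u →
      ∃ i', Attached (process (cycles k) G T₁) c i' u) :
    ∃ t₂ ≤ T₁ + (3 * #(ltPairs s) + s + 1) * (3 * b + 6),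
      ∃ (cl : V → V ⊕ (Fin s × Prop)) (S : Finset (V ⊕ (Fin s × Prop))),
        #S ≤ ∑ i, k i + 2 * #(ltPairs s) + 2 * s ∧ (∀ u ∈ nearSet G c T₁, cl u ∈ S) ∧
        ∀ u v, cl u = cl v → Twins (process (cycles k) G t₂) u v := by
  classical
  obtain ⟨a, ha, hprog⟩ := exists_eq_of_monotone_of_le (progress_mono (G := G) (c := c))
    progress_le T₁ (3 * b + 6)
  set t₀ := T₁ + a * (3 * b + 6) with ht₀
  set t₃ := T₁ + (a + 1) * (3 * b + 6) with ht₃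
  -- The quiet window splits as `b + 4` for the three-vertex rule, then `b + 1` up to `t₂` and `b +
  -- 1` beyond it for spreading along parity classes.
  have h03 : t₃ = t₀ + (3 * b + 6) := by rw [ht₃, ht₀]; ring
  have ht₃le : t₃ ≤ T₁ + (3 * #(ltPairs s) + s + 1) * (3 * b + 6) :=
    Nat.add_le_add_left (Nat.mul_le_mul_right _ (by omega)) _
  have hτ0 : τ ≤ t₀ := by omega
  obtain ⟨t₁, ht₁⟩ : ∃ t₁, t₁ = t₀ + b + 4 := ⟨_, rfl⟩
  obtain ⟨t₂, ht₂⟩ : ∃ t₂, t₂ = t₁ + b + 1 := ⟨_, rfl⟩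
  have hatt : ∀ {t j u}, t ≤ t₃ → Attached (process (cycles k) G t) c j u →
      Attached (process (cycles k) G t₁) c j u := fun ht hu =>
    attached_of_progress_eq hk h hb hT₁ hτ0 (by omega) (by omega) (by omega) hprog (hu.mono ht)
  have hdich : ∀ j,
      ((∀ u, Attached (process (cycles k) G t₁) c j u → ∀ x,
        (process (cycles k) G t₂).Adj u (c j x)) ∧
      ∀ u v, Attached (process (cycles k) G t₁) c j u → Attached (process (cycles k) G t₁) c j v →
        u ≠ v → (process (cycles k) G t₂).Adj u v) ∨
      ∀ u v, Attached (process (cycles k) G t₁) c j u → Attached (process (cycles k) G t₁) c j v →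
        (((process (cycles k) G t₂).Adj u (c j 0) ↔ (process (cycles k) G t₂).Adj v (c j 0)) →
        ∀ x, (process (cycles k) G t₂).Adj u (c j x) ↔ (process (cycles k) G t₂).Adj v (c j x)) ∧
        (u ≠ v → ((process (cycles k) G t₂).Adj u v ↔ ¬ ((process (cycles k) G t₂).Adj u (c j 0) ↔
          (process (cycles k) G t₂).Adj v (c j 0)))) := by
    intro j
    by_cases hj : HasFull G c t₃ j
    · left
      exact adj_of_hasFull hk h hτ0 (by omega) (by omega)
        (hasFull_of_progress_eq (by omega) hprog hj)
    · right
      intro u v hu hv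
      exact adj_iff_of_not_hasFull hk h hb (by omega) (by omega) (by omega) hj hu hv
  set P := process (cycles k) G t₂ with hP
  -- Exceptional or unattached vertices get singleton classes; the others are labelled by one chosen
  -- cycle and by their side, read off from adjacency to `c j 0`.
  let cl : V → V ⊕ (Fin s × Prop) := fun u =>
    if hu : u ∉ exceptionalSet G c t₁ ∧ ∃ j, Attached (process (cycles k) G t₁) c j u then
      Sum.inr (hu.2.choose, P.Adj u (c hu.2.choose 0)) else Sum.inl u
  refine ⟨t₂, by omega, cl,
    ((univ.filter fun u => ¬ Outside c u) ∪ exceptionalSet G c t₁).disjSum univ, ?_, ?_, ?_⟩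
  · rw [card_disjSum]
    have h1 := card_union_le (univ.filter fun u => ¬ Outside c u) (exceptionalSet G c t₁)
    have h2 := card_filter_not_outside_le (c := c) hk
    have h3 := card_exceptionalSet_le (G := G) (c := c) t₁
    have h4 : #(univ : Finset (Fin s × Prop)) = s * 2 := by simp
    omega
  · intro u hu
    by_cases hcl : u ∉ exceptionalSet G c t₁ ∧ ∃ j, Attached (process (cycles k) G t₁) c j u
    · simp only [cl]
      rw [dif_pos hcl]
      simp
    · simp only [cl]
      rw [dif_neg hcl, inl_mem_disjSum, mem_union]
      rcases mem_nearSet.1 hu with hu | ⟨i, hi⟩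
      · left; simpa using hu
      · right
        by_contra hex
        exact hcl ⟨hex, i, hi.mono (by omega)⟩
  · have key : ∀ u v j, u ∉ exceptionalSet G c t₁ → v ∉ exceptionalSet G c t₁ →
        Attached (process (cycles k) G t₁) c j u → Attached (process (cycles k) G t₁) c j v →
        (P.Adj u (c j 0) ↔ P.Adj v (c j 0)) → ∀ w, w ≠ u → w ≠ v → P.Adj u w → P.Adj v w := by
      intro u v j hue hve huj hvj huv w hwu hwv huw
      rcases eq_or_ne u v with rfl | hne
      · exact huw
      by_cases hw : Outside c w
      · obtain ⟨z, hz⟩ := huj.2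
        have hwj : Attached (process (cycles k) G t₁) c j w := by
          refine hatt (t := t₂ + 1) (by omega) ⟨hw, z - 3, ?_⟩
          exact process_adj_sub_three hk h hw huj.1 (t := t₂) (by omega) le_rfl huw.symm
            (process_adj_mono (by omega) hz)
        rcases hdich j with hj | hj
        · exact hj.2 v w hvj hwj hwv.symm
        · rw [(hj v w hvj hwj).2 hwv.symm, ← huv, ← (hj u w huj hwj).2 hwu.symm]
          exact huw
      · simp only [Outside, not_forall, not_not] at hw
        obtain ⟨i, x, rfl⟩ := hw
        have hui : Attached (process (cycles k) G t₁) c i u :=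
          hatt (t := t₂) (by omega) ⟨huj.1, x, huw⟩
        rcases eq_or_ne i j with rfl | hij
        · rcases hdich i with hi | hi
          · exact hi.1 v hvj x
          · exact ((hi u v huj hvj).1 huv x).1 huw
        · have hcard := three_le_card_of_notMem_exceptionalSet hue hij hui huj
          have hvi : Attached (process (cycles k) G t₁) c i v :=
            hatt (t := t₃) le_rfl (attached_of_three_le_card hk h hb hij.symm (by omega) (by omega)
              (by rwa [inter_comm]) hvj)
          rcases hdich i with hi | hi
          · exact hi.1 v hvi x
          by_cases hσ : P.Adj u (c i 0) ↔ P.Adj v (c i 0)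
          · exact ((hi u v hui hvi).1 hσ x).1 huw
          exfalso
          -- On opposite sides for `c i`, `u` and `v` are adjacent; being on the same side for `c
          -- j`, they force `c j` to be of clique type. A third common attached vertex then forms a
          -- triangle with them, which the bipartite pattern at `c i` forbids.
          have hadj : P.Adj u v := ((hi u v hui hvi).2 hne).2 hσ
          rcases hdich j with hj | hj
          swap
          · exact ((hj u v huj hvj).2 hne).1 hadj huv
          obtain ⟨w, hw, hwuv⟩ := exists_mem_notMem_of_card_lt_card
            (show #({u, v} : Finset V) < #(attachedSet G c t₁ i ∩ attachedSet G c t₁ j) from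
              lt_of_le_of_lt card_le_two (by omega))
          rw [mem_inter, mem_attachedSet, mem_attachedSet] at hw
          simp only [mem_insert, mem_singleton, not_or] at hwuv
          have h1 := ((hi w u hw.1 hui).2 hwuv.1).1 (hj.2 w u hw.2 huj hwuv.1)
          have h2 := ((hi w v hw.1 hvi).2 hwuv.2).1 (hj.2 w v hw.2 hvj hwuv.2)
          tauto
    intro u v huv
    by_cases hu : u ∉ exceptionalSet G c t₁ ∧ ∃ j, Attached (process (cycles k) G t₁) c j u <;>
      by_cases hv : v ∉ exceptionalSet G c t₁ ∧ ∃ j, Attached (process (cycles k) G t₁) c j v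
    · simp only [cl] at huv
      rw [dif_pos hu, dif_pos hv, Sum.inr.injEq, Prod.mk.injEq] at huv
      obtain ⟨hj, hσ⟩ := huv
      have hu2 := hu.2.choose_spec
      have hv2 := hv.2.choose_spec
      rw [← hj] at hσ hv2
      intro w hwu hwv
      exact ⟨key u v _ hu.1 hv.1 hu2 hv2 (iff_of_eq hσ) w hwu hwv,
        key v u _ hv.1 hu.1 hv2 hu2 (iff_of_eq hσ).symm w hwv hwu⟩
    · simp only [cl] at huv
      rw [dif_pos hu, dif_neg hv] at huv
      exact absurd huv (by simp)
    · simp only [cl] at huv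
      rw [dif_neg hu, dif_pos hv] at huv
      exact absurd huv (by simp)
    · simp only [cl] at huv
      rw [dif_neg hu, dif_neg hv, Sum.inl.injEq] at huv
      subst huv
      exact fun w _ _ => Iff.rfl

end Classes

/-! ### Twins persist, and limit the number of further steps. -/

section Twins

variable {W V : Type*} [Fintype V] {H : SimpleGraph W} {G : SimpleGraph V}

/-- Being twins means that the transposition of `u` and `v` is an automorphism, and the process
preserves automorphisms. -/
theorem Twins.step {u v : V} (h : Twins G u v) : Twins (step H G) u v := by
  classical
  have hσ : ∀ a b, G.Adj a b → G.Adj (Equiv.swap u v a) (Equiv.swap u v b) := by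
    have hone : ∀ a b, b ≠ u → b ≠ v → G.Adj a b → G.Adj (Equiv.swap u v a) b := by
      intro a b hbu hbv hab
      rcases eq_or_ne a u with rfl | hau
      · rw [Equiv.swap_apply_left]
        exact (h b hbu hbv).1 hab
      rcases eq_or_ne a v with rfl | hav
      · rw [Equiv.swap_apply_right]
        exact (h b hbu hbv).2 hab
      · rwa [Equiv.swap_apply_of_ne_of_ne hau hav]
    intro a b hab
    by_cases hb : b ≠ u ∧ b ≠ v
    · rw [Equiv.swap_apply_of_ne_of_ne hb.1 hb.2]
      exact hone a b hb.1 hb.2 hab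
    by_cases ha : a ≠ u ∧ a ≠ v
    · rw [Equiv.swap_apply_of_ne_of_ne ha.1 ha.2]
      exact (hone b a ha.1 ha.2 hab.symm).symm
    have hb' : b = u ∨ b = v := by tauto
    have ha' : a = u ∨ a = v := by tauto
    rcases ha' with rfl | rfl <;> rcases hb' with rfl | rfl
    · exact absurd rfl hab.ne
    · rw [Equiv.swap_apply_left, Equiv.swap_apply_right]; exact hab.symm
    · rw [Equiv.swap_apply_left, Equiv.swap_apply_right]; exact hab.symm
    · exact absurd rfl hab.ne
  intro w hwu hwv
  constructor
  · intro hw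
    have := step_adj_map (Equiv.swap u v) hσ hw
    rwa [Equiv.swap_apply_left, Equiv.swap_apply_of_ne_of_ne hwu hwv] at this
  · intro hw
    have := step_adj_map (Equiv.swap u v) hσ hw
    rwa [Equiv.swap_apply_right, Equiv.swap_apply_of_ne_of_ne hwu hwv] at this

theorem Twins.process {u v : V} {t T : ℕ} (hT : t ≤ T) (h : Twins (process H G t) u v) :
    Twins (Bootstrap.process H G T) u v := by
  induction T, hT using Nat.le_induction with
  | base => exact h
  | succ T _ ih => exact ih.step

omit [Fintype V] in
theorem adj_of_twins {β : Type*} {cl : V → β} (h : ∀ u v, cl u = cl v → Twins G u v)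
    {u v u' v' : V} (hu : cl u' = cl u) (hv : cl v' = cl v) (huv : u ≠ v) (hadj : G.Adj u' v') :
    G.Adj u v := by
  rcases eq_or_ne v' u with rfl | hne
  · exact ((h u' v (hu.trans hv) v' hadj.ne.symm huv).1 hadj).symm
  · have h1 := (h u' u hu v' hadj.ne.symm hne).1 hadj
    exact ((h v' v hv u hne.symm huv).1 h1.symm).symm

/-- If the vertices fall into classes of twins, then the number of steps that add edges is bounded
in terms of the number of classes. -/
theorem le_sq_of_forall_exists_new_adj {β : Type*} {cl : V → β} {S : Finset β} {A : Set V}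
    (hS : ∀ u ∈ A, cl u ∈ S) {t₂ : ℕ} (h : ∀ u v, cl u = cl v → Twins (process H G t₂) u v)
    {T R : ℕ} (hT : t₂ ≤ T) (hnew : ∀ i < R, ∃ u ∈ A, ∃ v ∈ A,
      (process H G (T + i + 1)).Adj u v ∧ ¬ (process H G (T + i)).Adj u v) :
    R ≤ #S * #S := by
  classical
  -- Pairs of classes joined by at least one edge. An edge between twin classes, or inside one,
  -- forces all of them, so a new edge always yields a new pair.
  let Q : ℕ → Finset (β × β) := fun i =>
    (S ×ˢ S).filter fun p => ∃ u v, cl u = p.1 ∧ cl v = p.2 ∧ (process H G (T + i)).Adj u v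
  have hQ : ∀ i ≤ R, i ≤ #(Q i) := by
    intro i hi
    induction i with
    | zero => exact Nat.zero_le _
    | succ i ih =>
      obtain ⟨u, hu, v, hv, hadj, hnadj⟩ := hnew i hi
      refine (Nat.succ_le_succ (ih (by omega))).trans (Nat.succ_le_of_lt (card_lt_card ?_))
      rw [ssubset_iff_of_subset]
      · refine ⟨(cl u, cl v), ?_, ?_⟩
        · exact mem_filter.2 ⟨mem_product.2 ⟨hS u hu, hS v hv⟩, u, v, rfl, rfl, hadj⟩
        · intro hmem
          obtain ⟨-, u', v', hu', hv', hadj'⟩ := mem_filter.1 hmem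
          exact hnadj (adj_of_twins (fun x y hxy => (h x y hxy).process (by omega)) hu' hv'
            hadj.ne hadj')
      · intro p hp
        obtain ⟨hp, u, v, h1, h2, h3⟩ := mem_filter.1 hp
        exact mem_filter.2 ⟨hp, u, v, h1, h2, process_mono H G (by omega) h3⟩
  refine (hQ R le_rfl).trans ((card_filter_le _ _).trans ?_)
  rw [card_product]

end Twins

/-! ### Components are invariant; those away from the cycles. -/

section Components

variable {V : Type*} [Fintype V] {s : ℕ} {k : Fin s → ℕ} {c : ∀ j, ZMod (k j) → V}
  {G : SimpleGraph V}

omit [Fintype V] in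
theorem reachable_of_isPathSeq {G : SimpleGraph V} {m : ℕ} {p : ℕ → V} (hp : IsPathSeq G m p) {i : ℕ}
    (hi : i < m) : G.Reachable (p 0) (p i) := by
  induction i with
  | zero => exact Reachable.refl _
  | succ i ih => exact (ih (by omega)).trans (hp.1 i hi).reachable

theorem reachable_of_process_adj (hk : ∀ i, 3 ≤ k i) (t : ℕ) {u v : V}
    (h : (process (cycles k) G t).Adj u v) : G.Reachable u v := by
  induction t generalizing u v with
  | zero => exact h.reachable
  | succ t ih =>
    by_cases hadj : (process (cycles k) G t).Adj u v
    · exact ih hadj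
    · obtain ⟨j, p, hp, rfl, rfl⟩ := exists_isPathSeq_of_step_adj hk h hadj
      have hkj := hk j
      have key : ∀ i < k j, G.Reachable (p 0) (p i) := by
        intro i hi
        induction i with
        | zero => exact Reachable.refl _
        | succ i ih' => exact (ih' (by omega)).trans (ih (hp.1 i hi))
      exact key _ (by omega)

theorem reachable_process_iff (hk : ∀ i, 3 ≤ k i) (t : ℕ) {u v : V} :
    (process (cycles k) G t).Reachable u v ↔ G.Reachable u v := by
  constructor
  · rintro ⟨w⟩
    induction w with
    | nil => exact Reachable.refl _
    | cons h _ ih => exact (reachable_of_process_adj hk t h).trans ih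
  · exact fun h => h.mono (process_mono (cycles k) G (Nat.zero_le t))

/-- In a component without cycles of the system, the process stops as soon as it pauses. -/
theorem adj_of_adj_succ_of_component (hk : ∀ i, 3 ≤ k i) {t : ℕ}
    (h : CycleSystem (process (cycles k) G t) c) {w : V} (hw : ∀ j x, ¬ G.Reachable w (c j x))
    (hpause : ∀ u v, G.Reachable w u → (process (cycles k) G (t + 1)).Adj u v →
      (process (cycles k) G t).Adj u v) :
    ∀ u v, G.Reachable w u → (process (cycles k) G (t + 2)).Adj u v →
      (process (cycles k) G (t + 1)).Adj u v := by
  intro u v hu huv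
  by_contra hn
  obtain ⟨j, p, hp, rfl, rfl⟩ := exists_isPathSeq_of_step_adj hk huv hn
  have hreach : ∀ i < k j, G.Reachable w (p i) := fun i hi =>
    hu.trans ((reachable_process_iff hk (t + 1)).1 (reachable_of_isPathSeq hp hi))
  refine hn (h.step_adj hk (j := j) (p := p) ⟨fun i hi => ?_, hp.2⟩ fun i hi => Or.inl ?_)
  · exact hpause _ _ (hreach i (by omega)) (hp.1 i hi)
  · intro i' x hx
    exact hw i' x (hx ▸ hreach i hi)

/-- Contrapositive of the pausing principle: a change at a late time forces one at every earlier
time from `τ` on. -/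
theorem exists_new_adj_of_component (hk : ∀ i, 3 ≤ k i) {τ : ℕ}
    (h : CycleSystem (process (cycles k) G τ) c) {w : V} (hw : ∀ j x, ¬ G.Reachable w (c j x))
    {t : ℕ} {u v : V} (hu : G.Reachable w u) (hadj : (process (cycles k) G (t + 1)).Adj u v)
    (hn : ¬ (process (cycles k) G t).Adj u v) {r : ℕ} (hr : τ ≤ r) (hrt : r ≤ t) :
    ∃ u v, G.Reachable w u ∧ (process (cycles k) G (r + 1)).Adj u v ∧
      ¬ (process (cycles k) G r).Adj u v := by
  by_contra! hcon
  have key : ∀ m, r ≤ m → ∀ u v, G.Reachable w u → (process (cycles k) G (m + 1)).Adj u v →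
      (process (cycles k) G m).Adj u v := by
    intro m hm
    induction m, hm using Nat.le_induction with
    | base => exact hcon
    | succ m hm ih => exact adj_of_adj_succ_of_component hk (cycleSystem_process h (by omega)) hw ih
  exact hn (key t hrt u v hu hadj)

/-- A component that changes contains a cycle, which may replace a cycle of the system. -/
theorem exists_cycleSystem_of_new_adj (hk : ∀ i, 3 ≤ k i) {t : ℕ}
    (h : CycleSystem (process (cycles k) G t) c) {w : V} (hw : ∀ j x, ¬ G.Reachable w (c j x))
    {u v : V} (hu : G.Reachable w u) (hadj : (process (cycles k) G (t + 1)).Adj u v)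
    (hn : ¬ (process (cycles k) G t).Adj u v) :
    ∃ c' : ∀ j, ZMod (k j) → V, CycleSystem (process (cycles k) G (t + 1)) c' ∧
      ∃ j x, G.Reachable w (c' j x) := by
  classical
  have : ∀ i, NeZero (k i) := fun i => ⟨by have := hk i; omega⟩
  obtain ⟨j, p, hp, rfl, rfl⟩ := exists_isPathSeq_of_step_adj hk hadj hn
  have hkj := hk j
  have hreach : ∀ i < k j, G.Reachable w (p i) := fun i hi =>
    hu.trans ((reachable_process_iff hk t).1 (reachable_of_isPathSeq hp hi))
  have h' := cycleSystem_process h (Nat.le_succ t)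
  refine ⟨Function.update c j fun z => p z.val, ⟨?_, ?_⟩, j, 0, ?_⟩
  · intro i i' x y hxy
    by_cases hi : i = j <;> by_cases hi' : i' = j
    · subst hi; subst hi'
      simp only [Function.update_self] at hxy
      rw [ZMod.val_injective _ (hp.2 _ (ZMod.val_lt x) _ (ZMod.val_lt y) hxy)]
    · subst hi
      rw [Function.update_self, Function.update_of_ne hi'] at hxy
      exact absurd (hxy ▸ hreach _ (ZMod.val_lt x)) (hw _ _)
    · subst hi'
      rw [Function.update_self, Function.update_of_ne hi] at hxy
      exact absurd (hxy ▸ hreach _ (ZMod.val_lt y)) (hw _ _)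
    · rw [Function.update_of_ne hi, Function.update_of_ne hi'] at hxy
      exact h.inj _ _ _ _ hxy
  · intro i x
    by_cases hi : i = j
    · subst hi
      simp only [Function.update_self]
      rcases ZMod.val_add_one_cases hkj x with ⟨h1, h2⟩ | ⟨h1, h2⟩
      · rw [h2]
        exact process_adj_mono (Nat.le_succ t) (hp.1 _ h1)
      · rw [h1, h2]
        exact hadj.symm
    · rw [Function.update_of_ne hi]
      exact h'.adj i x
  · rw [Function.update_self]
    exact hreach _ (ZMod.val_lt _)

end Components

/-! ### Assembling the upper bound. -/

section UpperBound

variable {V : Type*} [Fintype V] {s : ℕ} {k : Fin s → ℕ} {c : ∀ j, ZMod (k j) → V}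
  {G : SimpleGraph V}

/-- The number of late steps that add an edge to a component of the cycle system is bounded. -/
theorem le_sq_of_forall_new_adj_near (hk : ∀ i, 3 ≤ k i) {τ : ℕ}
    (h : CycleSystem (process (cycles k) G τ) c) {j₀ : Fin s} {b : ℕ} (hj₀ : k j₀ = b + 1)
    (hb : ∀ i, k i ≤ b + 1) {l : ℕ} (hl : Fintype.card V ≤ b ^ l) {T R : ℕ}
    (hT : τ + l + b + 1 + (3 * #(ltPairs s) + s + 1) * (3 * b + 6) ≤ T)
    (hnew : ∀ i < R, ∃ u v, (∃ j x, G.Reachable u (c j x)) ∧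
      (process (cycles k) G (T + i + 1)).Adj u v ∧ ¬ (process (cycles k) G (T + i)).Adj u v) :
    R ≤ (∑ i, k i + 2 * #(ltPairs s) + 2 * s) * (∑ i, k i + 2 * #(ltPairs s) + 2 * s) := by
  have hk₀ := hk j₀
  have hnear : ∀ u, (∃ j x, G.Reachable u (c j x)) →
      ¬ Outside c u ∨ ∃ i, Attached (process (cycles k) G (τ + l + b + 1)) c i u := by
    rintro u ⟨j, x, hu⟩
    exact exists_attached_of_reachable hk h hj₀ hl ((reachable_process_iff hk τ).2 hu) le_rfl
  obtain ⟨t₂, ht₂, cl, S, hS, hcl, htwins⟩ := exists_twin_classes hk h hb (by omega)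
    (T₁ := τ + l + b + 1) (by omega) (by
      rintro t i u ⟨hu, x, hux⟩
      exact (hnear u ⟨i, x, reachable_of_process_adj hk t hux⟩).resolve_left (not_not.2 hu))
  refine (le_sq_of_forall_exists_new_adj (A := {u | ∃ j x, G.Reachable u (c j x)})
    (fun u hu => hcl u (mem_nearSet.2 (hnear u hu))) htwins (T := T) (R := R) (by omega) ?_).trans
    (Nat.mul_le_mul hS hS)
  intro i hi
  obtain ⟨u, v, ⟨j, x, hu⟩, hadj, hn⟩ := hnew i hi
  exact ⟨u, ⟨j, x, hu⟩, v, ⟨j, x, (reachable_of_process_adj hk _ hadj).symm.trans hu⟩, hadj, hn⟩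

theorem runningTime_le_of_card_le (hk : ∀ i, 3 ≤ k i) {j₀ : Fin s} {b : ℕ} (hj₀ : k j₀ = b + 1)
    (hb : ∀ i, k i ≤ b + 1) {l : ℕ} (hl : Fintype.card V ≤ b ^ l) {M : ℕ}
    (hM : M = ∑ i, k i + 2 * #(ltPairs s) + 2 * s) :
    runningTime (cycles k) G ≤
      2 + l + b + 1 + (3 * #(ltPairs s) + s + 1) * (3 * b + 6) + 2 * (M * M) := by
  -- The initial `2` is the time at which a replacement system `c'` is available; `l + b + 1` steps
  -- attach all vertices, and the product covers the search for a quiet window. One term `M * M` is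
  -- then spent until components away from `c` are inactive, the other on the components of `c`.
  set T := 2 + l + b + 1 + (3 * #(ltPairs s) + s + 1) * (3 * b + 6) with hTdef
  by_contra! hlt
  have hne : ∀ t ≤ T + 2 * (M * M),
      step (cycles k) (process (cycles k) G t) ≠ process (cycles k) G t :=
    fun t ht heq => absurd (runningTime_le (H := cycles k) heq.symm) (by omega)
  obtain ⟨c, hc, hadj⟩ := exists_cycles_of_step_ne hk (hne 0 (Nat.zero_le _))
  have h : CycleSystem (process (cycles k) G 1) c := ⟨hc, hadj⟩
  have hfar : ∀ t, T + M * M ≤ t → ∀ u v, (process (cycles k) G (t + 1)).Adj u v →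
      ¬ (process (cycles k) G t).Adj u v → ∃ j x, G.Reachable u (c j x) := by
    intro t ht u v huv hn
    by_contra! hw
    have hall : ∀ r, 1 ≤ r → r ≤ t → ∃ u' v', G.Reachable u u' ∧
        (process (cycles k) G (r + 1)).Adj u' v' ∧ ¬ (process (cycles k) G r).Adj u' v' :=
      fun r hr hrt => exists_new_adj_of_component hk h hw (Reachable.refl u) huv hn hr hrt
    obtain ⟨u', v', hu', huv', hn'⟩ := hall 1 le_rfl (by omega)
    obtain ⟨c', hc', j, x, hjx⟩ := exists_cycleSystem_of_new_adj hk h hw hu' huv' hn'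
    have := le_sq_of_forall_new_adj_near hk hc' hj₀ hb hl (T := T) (R := M * M + 1) le_rfl (by
      intro i hi
      obtain ⟨u'', v'', hu'', huv'', hn''⟩ := hall (T + i) (by omega) (by omega)
      exact ⟨u'', v'', ⟨j, x, hu''.symm.trans hjx⟩, huv'', hn''⟩)
    rw [← hM] at this
    omega
  have := le_sq_of_forall_new_adj_near hk h hj₀ hb hl (T := T + M * M) (R := M * M + 1)
    (by omega) (by
      intro i hi
      obtain ⟨u, v, huv, hn⟩ : ∃ u v, (process (cycles k) G (T + M * M + i + 1)).Adj u v ∧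
          ¬ (process (cycles k) G (T + M * M + i)).Adj u v := by
        by_contra! hcon
        exact hne (T + M * M + i) (by omega)
          (le_antisymm (fun u v huv => hcon u v huv) (process_mono _ _ (Nat.le_succ _)))
      exact ⟨u, v, hfar _ (by omega) u v huv hn, huv, hn⟩)
  rw [← hM] at this
  omega

theorem additive_constant_le {s k b N M : ℕ} (hs : 2 ≤ s) (hk : 3 ≤ k) (hkb : k = b + 1)
    (hN : 2 * N + s = s * s) (hM : M ≤ s * k + 2 * N + 2 * s) :
    4 + b + (3 * N + s + 1) * (3 * b + 6) + 2 * (M * M) ≤ k ^ 3 * s ^ 4 := by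
  -- Thus `2 * (M * M)` takes two of three available copies of `k ^ 2 * s ^ 4`; the linear terms fit
  -- in the third, and `3 ≤ k`.
  have hM' : M ≤ k * s ^ 2 := by nlinarith
  have h1 : M * M ≤ k ^ 2 * s ^ 4 := by
    calc M * M ≤ (k * s ^ 2) * (k * s ^ 2) := Nat.mul_le_mul hM' hM'
      _ = k ^ 2 * s ^ 4 := by ring
  have h2 : 2 * (3 * N + s + 1) ≤ 3 * s ^ 2 := by nlinarith
  have h3 : 3 * b + 6 ≤ 4 * k := by omega
  have h4 : 2 * ((3 * N + s + 1) * (3 * b + 6)) ≤ 12 * (k * s ^ 2) := by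
    calc 2 * ((3 * N + s + 1) * (3 * b + 6)) = (2 * (3 * N + s + 1)) * (3 * b + 6) := by ring
      _ ≤ (3 * s ^ 2) * (4 * k) := Nat.mul_le_mul h2 h3
      _ = 12 * (k * s ^ 2) := by ring
  have h5 : 4 ≤ s ^ 2 := by nlinarith
  have h6 : 12 ≤ k * s ^ 2 := by nlinarith
  have h7 : 2 * (4 + b) ≤ k * s ^ 2 := by nlinarith
  have h8 : 12 * (k * s ^ 2) ≤ k ^ 2 * s ^ 4 := by
    calc 12 * (k * s ^ 2) ≤ (k * s ^ 2) * (k * s ^ 2) := Nat.mul_le_mul_right _ h6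
      _ = k ^ 2 * s ^ 4 := by ring
  have h9 : 3 * (k ^ 2 * s ^ 4) ≤ k ^ 3 * s ^ 4 := by
    calc 3 * (k ^ 2 * s ^ 4) ≤ k * (k ^ 2 * s ^ 4) := Nat.mul_le_mul_right _ hk
      _ = k ^ 3 * s ^ 4 := by ring
  omega

theorem maxRunningTime_lt (hk : ∀ i, 3 ≤ k i) (hs : 2 ≤ s) {j₀ : Fin s}
    (hj₀ : ∀ i, k i ≤ k j₀) {n : ℕ} (hn : 2 ≤ n) :
    (maxRunningTime (cycles k) n : ℝ) <
      Real.logb ((k j₀ : ℝ) - 1) n + (k j₀ : ℝ) ^ 3 * (s : ℝ) ^ 4 := by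
  have hk₀ := hk j₀
  obtain ⟨b, hb⟩ : ∃ b, k j₀ = b + 1 := ⟨k j₀ - 1, by omega⟩
  have hmax : maxRunningTime (cycles k) n ≤ 2 + Nat.clog b n + b + 1 +
      (3 * #(ltPairs s) + s + 1) * (3 * b + 6) +
      2 * ((∑ i, k i + 2 * #(ltPairs s) + 2 * s) * (∑ i, k i + 2 * #(ltPairs s) + 2 * s)) := by
    classical
    unfold maxRunningTime
    refine Finset.sup_le fun G _ => ?_
    refine runningTime_le_of_card_le hk hb (fun i => hb ▸ hj₀ i) ?_ rfl
    rw [Fintype.card_fin]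
    exact Nat.le_pow_clog (by omega) n
  have hsum : ∑ i, k i ≤ s * k j₀ := by
    simpa using sum_le_card_nsmul univ k (k j₀) fun i _ => hj₀ i
  have hconst := additive_constant_le hs hk₀ hb (two_mul_card_ltPairs s)
    (M := ∑ i, k i + 2 * #(ltPairs s) + 2 * s) (by omega)
  have hclog : (Nat.clog b n : ℝ) < Real.logb ((k j₀ : ℝ) - 1) n + 1 := by
    have h1 := Nat.pow_pred_clog_lt_self (b := b) (by omega) (show 1 < n by omega)
    have h2 : 0 < Nat.clog b n := Nat.clog_pos (by omega) hn
    have h3 : (k j₀ : ℝ) - 1 = b := by rw [hb]; push_cast; ring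
    have h4 : ((Nat.clog b n).pred : ℝ) < Real.logb ((k j₀ : ℝ) - 1) n := by
      rw [h3, Real.lt_logb_iff_rpow_lt (by exact_mod_cast (show 1 < b by omega))
        (by exact_mod_cast (show 0 < n by omega)), Real.rpow_natCast]
      exact_mod_cast h1
    have h5 : ((Nat.clog b n : ℕ) : ℝ) = ((Nat.clog b n).pred : ℝ) + 1 := by
      exact_mod_cast (Nat.succ_pred_eq_of_pos h2).symm
    linarith
  -- The spare `1` compensates for rounding the logarithm up, and keeps the final inequality strict.
  have htotal : maxRunningTime (cycles k) n + 1 ≤ Nat.clog b n + k j₀ ^ 3 * s ^ 4 := by omega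
  have htotal' : (maxRunningTime (cycles k) n : ℝ) + 1 ≤
      Nat.clog b n + (k j₀ : ℝ) ^ 3 * (s : ℝ) ^ 4 := by exact_mod_cast htotal
  linarith

end UpperBound

end Bootstrap

theorem theorem1p4 (s : ℕ) (hs : 2 ≤ s) (k : Fin s → ℕ) (hk : ∀ i, 3 ≤ k i) (hmono : Antitone k)
    (k₁ : ℕ) (hk₁ : k₁ = k ⟨0, by omega⟩) :
    ∃ N : ℕ, ∀ n : ℕ, N ≤ n →
      Real.logb ((k₁ : ℝ) - 1) (n : ℝ) - 1 ≤ (Bootstrap.maxRunningTime (Bootstrap.cycles k) n : ℝ) ∧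
      (Bootstrap.maxRunningTime (Bootstrap.cycles k) n : ℝ) <
        Real.logb ((k₁ : ℝ) - 1) (n : ℝ) + (k₁ : ℝ) ^ 3 * (s : ℝ) ^ 4 := by
  subst hk₁
  have hmax : ∀ i, k i ≤ k ⟨0, by omega⟩ := fun i => hmono (Fin.mk_le_of_le_val (Nat.zero_le _))
  refine ⟨2 * (∑ i, k i + k ⟨0, by omega⟩), fun n hn => ⟨?_, ?_⟩⟩
  · exact Bootstrap.logb_sub_one_le_maxRunningTime hk _ hmax hn
  · have := hk ⟨0, by omega⟩
    exact Bootstrap.maxRunningTime_lt hk hs hmax (by omega)
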